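/- Let $k$ be a field, $d\ge 2$ an integer, $S=k[[x,y]]$, and let $R=k[[x^d,x^{d-1}y,\ldots,xy^{d-1},y^d]]\subseteq S$ be the complete $d$-th Veronese subring, i.e. the ring of power series in the monomials $x^d,x^{d-1}y,\ldots,y^d$ (equivalently, the power series in $x,y$ all of whose monomials have degree divisible by $d$). For $0\le i\le d-1$ let $M_i=x^iR+x^{i-1}yR+\cdots+y^iR\subseteq S$ be the $R$-module generated by the monomials of degree $i$. For an $R$-module $B$ and $R$-modules $L\subseteq M$, the module closure is $$L_M^{\mathrm{cl}_B}=\{u\in M : b\otimes u\in \operatorname{im}(B\otimes_R L\to B\otimes_R M)\text{ for all } b\in B\}.$$ For a Cohen–Macaulay complete local ring $(A,\mathfrak m)$ of Krull dimension $n$, let $E$ be the injective hull of $A/\mathfrak m$ and let $\omega=\operatorname{Hom}_A(H^n_{\mathfrak m}(A),E)$ be the canonical module. For a closure operation $\mathrm{cl}$ on $A$-modules put $$\tau_{\mathrm{cl}}(\omega)=\{f\in\omega : f(0^{\mathrm{cl}}_{H^n_{\mathfrak m}(A)})=0\};$$ $A$ is called $\mathrm{cl}$-rational if $\tau_{\mathrm{cl}}(\omega)=\omega$.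 Then $R$ is a Noetherian complete local Cohen–Macaulay ring, each $M_i$ with $0\le i\le d-1$ is a maximal Cohen–Macaulay $R$-module, and 1. $R$ is $\mathrm{cl}_{M_i}$-rational for every $0\le i\le d-2$; 2. $R$ is not $\mathrm{cl}_{M_{d-1}}$-rational. -/

import Mathlib

open scoped TensorProduct

universe u

noncomputable section

/-! ### Closure operations on modules -/

/-- A closure operation on the category of all `R`-modules. -/
structure ModClosure (R : Type u) [CommRing R] where
  /-- The closure `L_M^cl` of a submodule `L` of `M`. -/
  cl : ∀ (M : Type u) [AddCommGroup M] [Module R M], Submodule R M → Submodule R M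
  le_cl : ∀ (M : Type u) [AddCommGroup M] [Module R M] (L : Submodule R M), L ≤ cl M L
  cl_cl : ∀ (M : Type u) [AddCommGroup M] [Module R M] (L : Submodule R M),
    cl M (cl M L) = cl M L
  mono : ∀ (M : Type u) [AddCommGroup M] [Module R M] (L L' : Submodule R M),
    L ≤ L' → cl M L ≤ cl M L'

/-- The submodule `{x ∈ M | b ⊗ x ∈ im (B ⊗ L → B ⊗ M) for all b ∈ B}` of `M`. -/
def moduleClosureSubmodule (R : Type u) [CommRing R] (B : Type u) [AddCommGroup B] [Module R B]
    (M : Type u) [AddCommGroup M] [Module R M] (L : Submodule R M) : Submodule R M where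
  carrier := {x | ∀ b : B, b ⊗ₜ[R] x ∈ LinearMap.range (LinearMap.lTensor B L.subtype)}
  zero_mem' := fun b => by rw [TensorProduct.tmul_zero]; exact Submodule.zero_mem _
  add_mem' := fun {x y} hx hy b => by
    rw [TensorProduct.tmul_add]; exact Submodule.add_mem _ (hx b) (hy b)
  smul_mem' := fun r x hx b => by
    rw [TensorProduct.tmul_smul]; exact Submodule.smul_mem _ r (hx b)

/-- The module closure `cl_B` coming from an `R`-module `B`. -/
def moduleClosure (R : Type u) [CommRing R] (B : Type u) [AddCommGroup B] [Module R B] :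
    ModClosure R where
  cl M _ _ L := moduleClosureSubmodule R B M L
  le_cl M _ _ L := fun x hx b => ⟨b ⊗ₜ[R] (⟨x, hx⟩ : L), by simp⟩
  cl_cl M _ _ L := by
    apply le_antisymm
    · intro x hx b
      obtain ⟨t, ht⟩ := hx b
      rw [← ht]
      clear ht
      induction t using TensorProduct.induction_on with
      | zero => simp
      | tmul b' l => simpa using l.2 b'
      | add s t hs ht => rw [map_add]; exact Submodule.add_mem _ hs ht
    · exact fun x hx b => ⟨b ⊗ₜ[R] (⟨x, hx⟩ : moduleClosureSubmodule R B M L), by simp⟩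
  mono M _ _ L L' h := by
    intro x hx b
    obtain ⟨t, ht⟩ := hx b
    refine ⟨LinearMap.lTensor B (Submodule.inclusion h) t, ?_⟩
    rw [← ht, ← LinearMap.comp_apply, ← LinearMap.lTensor_comp]
    rfl

/-! ### Injective hulls -/

/-- `f : N → E` is an injective hull of `N`: `E` is injective and `f` is an essential
monomorphism. -/
structure IsInjectiveHull (R : Type u) [CommRing R] {N E : Type u} [AddCommGroup N] [Module R N]
    [AddCommGroup E] [Module R E] (f : N →ₗ[R] E) : Prop where
  injective : Function.Injective f
  injective_module : Module.Injective R E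
  essential : ∀ C : Submodule R E, C ⊓ LinearMap.range f = ⊥ → C = ⊥

theorem exists_isInjectiveHull (R : Type u) [CommRing R] (N : Type u) [AddCommGroup N]
    [Module R N] :
    ∃ (E : ModuleCat.{u} R) (f : N →ₗ[R] E), IsInjectiveHull R f := by
  obtain ⟨⟨J, hJ, ι, hι⟩⟩ := CategoryTheory.EnoughInjectives.presentation (ModuleCat.of R N)
  have hJ' : Module.Injective R J := (Module.injective_iff_injective_object R J).mpr hJ
  let g : N →ₗ[R] J := ι.hom
  have hg : Function.Injective g := (ModuleCat.mono_iff_injective ι).mp hι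
  let N' : Submodule R J := LinearMap.range g
  -- a maximal essential extension of `N'` inside `J`
  obtain ⟨E, hNE, hE⟩ : ∃ E, N' ≤ E ∧ Maximal (fun E : Submodule R J =>
      ∀ C ≤ E, C ⊓ N' = ⊥ → C = ⊥) E := by
    refine zorn_le_nonempty₀ {E : Submodule R J | ∀ C ≤ E, C ⊓ N' = ⊥ → C = ⊥} ?_ N' ?_
    · intro c hc hchain y hy
      refine ⟨sSup c, ?_, fun z hz => le_sSup hz⟩
      intro C hC hCN
      rw [eq_bot_iff]
      intro x hx
      obtain ⟨F, hF, hxF⟩ :=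
        (Submodule.mem_sSup_of_directed ⟨y, hy⟩ hchain.directedOn).mp (hC hx)
      have := hc hF (C ⊓ F) inf_le_right
        (by rw [eq_bot_iff, ← hCN]; exact inf_le_inf_right _ inf_le_left)
      rw [← this]
      exact ⟨hx, hxF⟩
    · intro C hC hCN
      rwa [inf_eq_left.mpr hC] at hCN
  -- a maximal submodule of `J` meeting `E` trivially
  obtain ⟨D, -, hD⟩ : ∃ D, ⊥ ≤ D ∧ Maximal (fun D : Submodule R J => D ⊓ E = ⊥) D := by
    refine zorn_le_nonempty₀ {D : Submodule R J | D ⊓ E = ⊥} ?_ ⊥ (bot_inf_eq _)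
    intro c hc hchain y hy
    refine ⟨sSup c, ?_, fun z hz => le_sSup hz⟩
    change sSup c ⊓ E = ⊥
    rw [eq_bot_iff]
    rintro x ⟨hx, hxE⟩
    obtain ⟨F, hF, hxF⟩ := (Submodule.mem_sSup_of_directed ⟨y, hy⟩ hchain.directedOn).mp hx
    have : F ⊓ E = ⊥ := hc hF
    rw [← this]
    exact ⟨hxF, hxE⟩
  let q : E →ₗ[R] J ⧸ D := D.mkQ ∘ₗ E.subtype
  have hq : Function.Injective q := by
    rw [← LinearMap.ker_eq_bot, eq_bot_iff]
    intro x hx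
    have hxD : (x : J) ∈ D := by simpa [q] using hx
    have : (x : J) ∈ D ⊓ E := ⟨hxD, x.2⟩
    rw [hD.prop] at this
    simpa using this
  obtain ⟨φ, hφ⟩ := hJ'.out q hq E.subtype
  have hφ' : ∀ x ∈ E, φ (D.mkQ x) = x := fun x hx => hφ ⟨x, hx⟩
  let ψ : J →ₗ[R] J := φ ∘ₗ D.mkQ
  have hker : LinearMap.ker ψ = D := by
    refine (hD.eq_of_le ?_ ?_).symm
    · rw [eq_bot_iff]
      rintro x ⟨hx, hxE⟩
      have h1 : ψ x = 0 := hx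
      have h2 : ψ x = x := hφ' x hxE
      rw [h2] at h1
      exact h1
    · intro x hx
      have : D.mkQ x = 0 := by simpa using hx
      simp [ψ, this]
  have hEle : E ≤ LinearMap.range ψ := fun x hx => ⟨x, hφ' x hx⟩
  have hrange : E = LinearMap.range ψ := by
    refine hE.eq_of_le ?_ hEle
    intro C hC hCN
    have hCE : C ⊓ E = ⊥ :=
      hE.prop _ inf_le_right
        (by rw [eq_bot_iff, ← hCN]; exact inf_le_inf_right _ inf_le_left)
    have h1 : D = C.comap ψ := by
      refine hD.eq_of_le ?_ ?_
      · rw [eq_bot_iff]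
        rintro x ⟨hx, hxE⟩
        have h2 : ψ x = x := hφ' x hxE
        have h3 : ψ x ∈ C := hx
        rw [h2] at h3
        rw [← hCE]
        exact ⟨h3, hxE⟩
      · intro x hx
        rw [← hker] at hx
        have : ψ x = 0 := hx
        simp [this]
    rw [eq_bot_iff]
    intro x hx
    obtain ⟨y, rfl⟩ := hC hx
    have : y ∈ D := by rw [h1]; exact hx
    rw [← hker] at this
    simpa using this
  let ρ : J →ₗ[R] E := ψ.codRestrict E (fun x => by rw [hrange]; exact ⟨x, rfl⟩)
  have hρ : ∀ x : E, ρ x = x := fun x => Subtype.ext (hφ' x x.2)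
  refine ⟨ModuleCat.of R E, g.codRestrict E (fun x => hNE ⟨x, rfl⟩), ?_, ?_, ?_⟩
  · intro x y hxy
    exact hg (congrArg Subtype.val hxy)
  · refine ⟨fun X Y _ _ _ _ f hf k => ?_⟩
    obtain ⟨h, hh⟩ := hJ'.out f hf (E.subtype ∘ₗ k)
    exact ⟨ρ ∘ₗ h, fun x => by
      change ρ (h (f x)) = k x
      rw [hh x]; exact hρ (k x)⟩
  · intro C hC
    change Submodule R E at C
    have h1 : C.map E.subtype = ⊥ := by
      refine hE.prop _ (Submodule.map_subtype_le E C) ?_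
      rw [eq_bot_iff]
      rintro x ⟨⟨y, hy, rfl⟩, ⟨n, hn⟩⟩
      have : y ∈ C ⊓ LinearMap.range (g.codRestrict E (fun x => hNE ⟨x, rfl⟩)) :=
        ⟨hy, ⟨n, Subtype.ext hn⟩⟩
      have h2 : y = 0 := by
        have h3 : C ⊓ LinearMap.range (g.codRestrict E (fun x => hNE ⟨x, rfl⟩)) = ⊥ := hC
        rw [h3] at this
        simpa using this
      simp [h2]
    exact Submodule.map_injective_of_injective (f := E.subtype) Subtype.val_injective
      (h1.trans (Submodule.map_bot E.subtype).symm)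

/-- An injective hull of the `R`-module `N`. -/
def injectiveHull (R : Type u) [CommRing R] (N : Type u) [AddCommGroup N] [Module R N] :
    ModuleCat.{u} R :=
  (exists_isInjectiveHull R N).choose

/-- The embedding of `N` into its injective hull. -/
def injectiveHullEmbedding (R : Type u) [CommRing R] (N : Type u) [AddCommGroup N]
    [Module R N] : N →ₗ[R] injectiveHull R N :=
  (exists_isInjectiveHull R N).choose_spec.choose

theorem injectiveHullEmbedding_isInjectiveHull (R : Type u) [CommRing R] (N : Type u)
    [AddCommGroup N] [Module R N] : IsInjectiveHull R (injectiveHullEmbedding R N) :=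
  (exists_isInjectiveHull R N).choose_spec.choose_spec

/-! ### Canonical module, test submodule and rationality -/

/-- The Matlis dual `Hom_R (M, E_R(k))` over a local ring `R` with residue field `k`. -/
abbrev MatlisDual (R : Type u) [CommRing R] [IsLocalRing R] (M : Type u) [AddCommGroup M]
    [Module R M] : Type u :=
  M →ₗ[R] injectiveHull R (IsLocalRing.ResidueField R)

/-- The top local cohomology module `H_m^d(R)`, where `d` is the Krull dimension of the local
ring `R` and `m` its maximal ideal. -/
def topLocalCohomology (R : Type u) [CommRing R] [IsLocalRing R] : ModuleCat.{u} R :=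
  (localCohomology (IsLocalRing.maximalIdeal R) ((ringKrullDim R).unbotD 0).toNat).obj
    (ModuleCat.of R R)

/-- The canonical module of a Cohen-Macaulay complete local ring `R`, as the Matlis dual of
`H_m^d(R)`. -/
abbrev CanonicalModule (R : Type u) [CommRing R] [IsLocalRing R] : Type u :=
  MatlisDual R (topLocalCohomology R)

/-- The annihilator `Ann_ω N = {f : H_m^d(R) → E_R(k) | f(N) = 0}` in the canonical module of a
submodule `N` of `H_m^d(R)`. -/
def annCanonical (R : Type u) [CommRing R] [IsLocalRing R]
    (N : Submodule R (topLocalCohomology R)) : Submodule R (CanonicalModule R) where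
  carrier := {f | ∀ x ∈ N, f x = 0}
  zero_mem' := fun _ _ => rfl
  add_mem' := fun {f g} hf hg x hx => by simp [hf x hx, hg x hx]
  smul_mem' := fun r f hf x hx => by simp [hf x hx]

/-- `τ_cl(ω)`, the annihilator in `ω` of the closure of `0` in `H_m^d(R)`. -/
def testSubmodule (R : Type u) [CommRing R] [IsLocalRing R] (c : ModClosure R) :
    Submodule R (CanonicalModule R) :=
  annCanonical R (c.cl (topLocalCohomology R) ⊥)

/-- A Cohen-Macaulay complete local ring `R` is `cl`-rational if `τ_cl(ω) = ω`. -/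
def IsClRational (R : Type u) [CommRing R] [IsLocalRing R] (c : ModClosure R) : Prop :=
  testSubmodule R c = ⊤

/-- `M` is a maximal Cohen-Macaulay module over the local ring `R`: it is finitely generated and
there is an `M`-regular sequence in the maximal ideal whose length is the dimension of `R`. -/
def IsMaximalCohenMacaulay (R : Type u) [CommRing R] [IsLocalRing R] (M : Type u)
    [AddCommGroup M] [Module R M] : Prop :=
  Module.Finite R M ∧ ∃ rs : List R, (∀ r ∈ rs, r ∈ IsLocalRing.maximalIdeal R) ∧
    RingTheory.Sequence.IsRegular M rs ∧ ringKrullDim R = (rs.length : WithBot ℕ∞)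

/-! ### The Veronese subring -/

/-- The Veronese subring `R = k⟦x^d, x^(d-1) y, …, y^d⟧` of `S = k⟦x, y⟧`, described as the ring of
power series all of whose monomials have degree divisible by `d`;
see `mem_veronese_iff_exists_subst`. -/
def veronese (k : Type u) [Field k] (d : ℕ) : Subalgebra k (MvPowerSeries (Fin 2) k) where
  carrier := {f | ∀ e : Fin 2 →₀ ℕ, ¬ d ∣ e.degree → MvPowerSeries.coeff e f = 0}
  add_mem' := fun {f g} hf hg e he => by rw [map_add, hf e he, hg e he, add_zero]
  mul_mem' := fun {f g} hf hg e he => by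
    classical
    rw [MvPowerSeries.coeff_mul]
    refine Finset.sum_eq_zero fun p hp => ?_
    rw [Finset.HasAntidiagonal.mem_antidiagonal] at hp
    by_cases h1 : d ∣ p.1.degree
    · have h2 : ¬ d ∣ p.2.degree := fun h2 => he (by
        rw [← hp, map_add]; exact dvd_add h1 h2)
      rw [hg _ h2, mul_zero]
    · rw [hf _ h1, zero_mul]
  algebraMap_mem' := fun c e he => by
    classical
    rw [MvPowerSeries.algebraMap_apply, MvPowerSeries.coeff_C, if_neg]
    rintro rfl
    simp at he

theorem mem_veronese {k : Type u} [Field k] {d : ℕ} {f : MvPowerSeries (Fin 2) k} :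
    f ∈ veronese k d ↔ ∀ e : Fin 2 →₀ ℕ, ¬ d ∣ e.degree → MvPowerSeries.coeff e f = 0 :=
  Iff.rfl

/-- The elements of the Veronese subring are the power series in the monomials
`x^d, x^(d-1) y, …, y^d`. -/
theorem mem_veronese_iff_exists_subst {k : Type u} [Field k] {d : ℕ} (hd : d ≠ 0)
    (f : MvPowerSeries (Fin 2) k) :
    f ∈ veronese k d ↔ ∃ g : MvPowerSeries (Fin (d + 1)) k,
      f = MvPowerSeries.subst (fun j : Fin (d + 1) =>
        (MvPowerSeries.X 0 ^ (d - (j : ℕ)) * MvPowerSeries.X 1 ^ (j : ℕ) :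
          MvPowerSeries (Fin 2) k)) g := by
  classical
  set a : Fin (d + 1) → MvPowerSeries (Fin 2) k := fun j =>
    MvPowerSeries.X 0 ^ (d - (j : ℕ)) * MvPowerSeries.X 1 ^ (j : ℕ) with ha_def
  let w : Fin (d + 1) → (Fin 2 →₀ ℕ) := fun j =>
    Finsupp.single 0 (d - (j : ℕ)) + Finsupp.single 1 (j : ℕ)
  have haw : ∀ j, a j = MvPowerSeries.monomial (w j) 1 := fun j => by
    simp only [ha_def, w, MvPowerSeries.X_pow_eq, MvPowerSeries.monomial_mul_monomial, one_mul]
  have hwdeg : ∀ j, (w j).degree = d := fun j => by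
    have := j.2
    simp only [w, map_add, Finsupp.degree_single]
    omega
  have hw0 : ∀ j, w j ≠ 0 := fun j h => hd (by rw [← hwdeg j, h, map_zero])
  have ha : MvPowerSeries.HasSubst a := by
    refine MvPowerSeries.hasSubst_of_constantCoeff_zero fun j => ?_
    rw [haw, ← MvPowerSeries.coeff_zero_eq_constantCoeff_apply, MvPowerSeries.coeff_monomial,
      if_neg (hw0 j).symm]
  let φ : (Fin (d + 1) →₀ ℕ) →+ (Fin 2 →₀ ℕ) :=
    { toFun := fun n => n.sum fun j m => m • w j
      map_zero' := Finsupp.sum_zero_index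
      map_add' := fun m n => Finsupp.sum_add_index' (by simp) (by intros; rw [add_smul]) }
  have hφs : ∀ (j : Fin (d + 1)) (m : ℕ), φ (Finsupp.single j m) = m • w j := fun j m =>
    Finsupp.sum_single_index (h := fun j m => m • w j) (zero_smul ℕ (w j))
  have hprod : ∀ n : Fin (d + 1) →₀ ℕ,
      (n.prod fun j m => a j ^ m) = MvPowerSeries.monomial (φ n) 1 := by
    intro n
    induction n using Finsupp.induction_linear with
    | zero => simp [MvPowerSeries.monomial_zero_one]
    | add m n hm hn =>
      rw [Finsupp.prod_add_index' (by simp) (by intros; rw [pow_add]), hm, hn, map_add,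
        MvPowerSeries.monomial_mul_monomial, one_mul]
    | single j m =>
      rw [Finsupp.prod_single_index (by simp), haw, MvPowerSeries.monomial_pow, one_pow, hφs]
  have hφdeg : ∀ n, d ∣ (φ n).degree := by
    intro n
    induction n using Finsupp.induction_linear with
    | zero => simp
    | add m n hm hn => rw [map_add, map_add]; exact dvd_add hm hn
    | single j m =>
      rw [hφs, map_nsmul, hwdeg]
      simp
  have hφw : ∀ j, φ (Finsupp.single j 1) = w j := fun j => by
    rw [hφs, one_smul]
  have hsurj : ∀ (m : ℕ) (e : Fin 2 →₀ ℕ), e.degree = d * m → ∃ n, φ n = e := by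
    intro m
    induction m with
    | zero =>
      intro e he
      rw [mul_zero, Finsupp.degree_eq_zero_iff] at he
      exact ⟨0, by rw [map_zero, he]⟩
    | succ m ih =>
      intro e he
      have he' : e 0 + e 1 = d * m + d := by
        rw [← mul_add_one, ← he, Finsupp.degree_eq_sum, Fin.sum_univ_two]
      let j : Fin (d + 1) := ⟨min (e 1) d, by omega⟩
      have hle : w j ≤ e := by
        intro s
        have hj : (j : ℕ) = min (e 1) d := rfl
        fin_cases s
        · simp [w, hj]; omega
        · simp [w, hj]
      obtain ⟨c, hc⟩ := exists_add_of_le hle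
      obtain ⟨n, hn⟩ := ih c (by
        rw [hc, map_add, hwdeg, mul_add_one] at he; omega)
      exact ⟨Finsupp.single j 1 + n, by rw [map_add, hφw, hn, hc]⟩
  have hcoeff : ∀ (g : MvPowerSeries (Fin (d + 1)) k) (e : Fin 2 →₀ ℕ),
      MvPowerSeries.coeff e (MvPowerSeries.subst a g) =
        ∑ᶠ n, MvPowerSeries.coeff n g * (if e = φ n then 1 else 0) := by
    intro g e
    rw [MvPowerSeries.coeff_subst ha]
    refine finsum_congr fun n => ?_
    rw [hprod, MvPowerSeries.coeff_monomial, smul_eq_mul]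
  constructor
  · intro hf
    let σ : (Fin 2 →₀ ℕ) → (Fin (d + 1) →₀ ℕ) := Function.invFun φ
    let g : MvPowerSeries (Fin (d + 1)) k := fun n =>
      if σ (φ n) = n then MvPowerSeries.coeff (φ n) f else 0
    have hg : ∀ n, MvPowerSeries.coeff n g =
      if σ (φ n) = n then MvPowerSeries.coeff (φ n) f else 0 := fun n => rfl
    refine ⟨g, ?_⟩
    ext e
    rw [hcoeff]
    by_cases he : ∃ n, φ n = e
    · have hσ : φ (σ e) = e := Function.invFun_eq he
      rw [finsum_eq_single _ (σ e)]
      · rw [hg, hσ, if_pos rfl, if_pos rfl, mul_one]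
      · intro n hn
        by_cases hen : e = φ n
        · rw [hg, ← hen, if_neg (Ne.symm hn), zero_mul]
        · rw [if_neg hen, mul_zero]
    · have h1 : ¬ d ∣ e.degree := by
        rintro ⟨m, hm⟩
        exact he (hsurj m e hm)
      rw [mem_veronese.mp hf e h1, eq_comm]
      apply finsum_eq_zero_of_forall_eq_zero
      intro n
      rw [if_neg (fun h => he ⟨n, h.symm⟩), mul_zero]
  · rintro ⟨g, rfl⟩ e he
    rw [hcoeff]
    apply finsum_eq_zero_of_forall_eq_zero
    intro n
    rw [if_neg (fun h => he (by rw [h]; exact hφdeg n)), mul_zero]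

instance veronese_isLocalRing (k : Type u) [Field k] (d : ℕ) : IsLocalRing (veronese k d) := by
  classical
  have hloc : IsLocalHom (algebraMap (veronese k d) (MvPowerSeries (Fin 2) k)) := by
    refine ⟨fun f hf => ?_⟩
    obtain ⟨g, hg⟩ := hf.exists_right_inv
    change (f : MvPowerSeries (Fin 2) k) * g = 1 at hg
    let g₀ : MvPowerSeries (Fin 2) k := fun e =>
      if d ∣ e.degree then MvPowerSeries.coeff e g else 0
    have hg₀ : ∀ e, MvPowerSeries.coeff e g₀ =
      if d ∣ e.degree then MvPowerSeries.coeff e g else 0 := fun e => rfl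
    have hmem : g₀ ∈ veronese k d := fun e he => by rw [hg₀, if_neg he]
    have hmul : (f : MvPowerSeries (Fin 2) k) * g₀ = 1 := by
      ext e
      by_cases he : d ∣ e.degree
      · rw [← hg, MvPowerSeries.coeff_mul, MvPowerSeries.coeff_mul]
        refine Finset.sum_congr rfl fun p hp => ?_
        rw [Finset.HasAntidiagonal.mem_antidiagonal] at hp
        by_cases h1 : d ∣ p.1.degree
        · have h2 : d ∣ p.2.degree := by
            rw [← hp, map_add] at he
            exact (Nat.dvd_add_right h1).mp he
          rw [hg₀, if_pos h2]
        · rw [f.2 _ h1, zero_mul, zero_mul]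
      · rw [((f : MvPowerSeries (Fin 2) k) * g₀ |> fun h => (veronese k d).mul_mem f.2 hmem) e he,
          (veronese k d).one_mem e he]
    exact IsUnit.of_mul_eq_one (⟨g₀, hmem⟩ : veronese k d) (Subtype.ext hmul)
  exact RingHom.domain_isLocalRing (algebraMap (veronese k d) (MvPowerSeries (Fin 2) k))

/-- The `R`-submodule `M_i = x^i R + x^(i-1) y R + ⋯ + y^i R` of `S = k⟦x, y⟧` over the Veronese
subring `R`. -/
def veroneseModule (k : Type u) [Field k] (d i : ℕ) :
    Submodule (veronese k d) (MvPowerSeries (Fin 2) k) :=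
  Submodule.span (veronese k d) (Set.range fun j : Fin (i + 1) =>
    (MvPowerSeries.X 0 ^ (i - (j : ℕ)) * MvPowerSeries.X 1 ^ (j : ℕ) : MvPowerSeries (Fin 2) k))

end

/-! Since the injective hull of the residue field is a cogenerator, rationality for `cl` means
exactly that the zero submodule of H, the top local cohomology, is closed (`isClRational_iff`). For
a module closure this says that no nonzero z in H satisfies b ⊗ z = 0 for all b in M_i. So the task
is to make H explicit and to detect its nonzero elements.

The ring has dimension 2, and x^d, y^d is a regular sequence whose powers generate ideals with
radical the maximal ideal. Koszul resolutions then present H as the colimit of the quotients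
R/(x^(dN), y^(dN)), with transition maps multiplication by x^d y^d
(`exists_localCohomology_two_classes`). A class [r] at level t pairs with any s in S = k[[x,y]] by
the coefficient of (xy)^(d(t+1)-1) in r s; this respects the transition maps and is balanced over R
(`exists_classes_residuePairing`). Pairing with all of S matters: a monomial of r in R has a
complement of degree congruent to -2 modulo d, usually outside R.

For i ≤ d - 2: if [r] ≠ 0, then r has a monomial x^a y^b with a, b < d(t+1). The complementary
monomial has degree congruent to -2, hence at least d - 2 ≥ i, so it factors as w v with v a
monomial in M_i. The functional m ⊗ h ↦ ⟨h, w m⟩ sends v ⊗ [r] to the coefficient of x^a y^b in r,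
which is nonzero, so [r] is not in the closure of 0.

For i = d - 1: the class of x^(d-1) y at level 0 pairs to 1 with y^(d-2), so it is nonzero. But
x^(d-1) y M_(d-1) lies in (x^d, y^d) M_(d-1) (`exists_monomial_mul_eq_smul_add_smul`), and x^d, y^d
kill the class of 1, so this class tensors to zero with all of M_(d-1). -/

noncomputable section

open CategoryTheory CategoryTheory.Limits Opposite

/-! ### Homology of a chain complex at a place where the incoming differential vanishes. -/

namespace HomologicalComplex

variable {D : Type*} [Category D] [Abelian D] {K L : ChainComplex D ℕ} (n : ℕ)

/-- The embedding of the homology in degree `n` into `Kₙ` if the differential `Kₙ₊₁ ⟶ Kₙ`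
vanishes. -/
def homologyToX (K : ChainComplex D ℕ) (h : K.d (n + 1) n = 0) : K.homology n ⟶ K.X n :=
  K.homologyι n ≫ (K.pOpcyclesIso (n + 1) n (by simp) h).inv

instance (h : K.d (n + 1) n = 0) : Mono (homologyToX n K h) := by
  unfold homologyToX
  infer_instance

theorem homologyToX_naturality (φ : K ⟶ L) (hK : K.d (n + 1) n = 0) (hL : L.d (n + 1) n = 0) :
    homologyMap φ n ≫ homologyToX n L hL = homologyToX n K hK ≫ φ.f n := by
  unfold homologyToX
  rw [homologyι_naturality_assoc, Category.assoc]
  congr 1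
  rw [Iso.eq_inv_comp, ← Category.assoc, Iso.comp_inv_eq, pOpcyclesIso_hom, pOpcyclesIso_hom,
    p_opcyclesMap]

theorem pOpcyclesIso_inv_comp_d (h : K.d (n + 2) (n + 1) = 0) :
    (K.pOpcyclesIso (n + 2) (n + 1) (by simp) h).inv ≫ K.d (n + 1) n =
      K.fromOpcycles (n + 1) n := by
  rw [Iso.inv_comp_eq, pOpcyclesIso_hom, p_fromOpcycles]

theorem homologyToX_comp_d (h : K.d (n + 2) (n + 1) = 0) :
    homologyToX (n + 1) K h ≫ K.d (n + 1) n = 0 := by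
  unfold homologyToX
  rw [Category.assoc, pOpcyclesIso_inv_comp_d, homologyι_comp_fromOpcycles]

/-- With no boundaries in degree n + 1, the opcycles there are the whole term of the complex, so
homology is the kernel of the outgoing differential. -/
theorem homologyToX_exact (h : K.d (n + 2) (n + 1) = 0) :
    (ShortComplex.mk _ _ (homologyToX_comp_d n h)).Exact := by
  let e : ShortComplex.mk _ _ (homologyToX_comp_d n h) ≅
      ShortComplex.mk _ _ (K.homologyι_comp_fromOpcycles (n + 1) n) :=
    ShortComplex.isoMk (Iso.refl _) (K.pOpcyclesIso (n + 2) (n + 1) (by simp) h) (Iso.refl _)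
      (by simp [homologyToX]) (by simp [← pOpcyclesIso_inv_comp_d n h])
  refine ShortComplex.exact_of_iso e.symm ?_
  exact ShortComplex.exact_of_f_is_kernel _ (K.homologyIsKernel (n + 1) n (by simp))

end HomologicalComplex

/-! ### Left derived functors at the end of a finite projective resolution. -/

namespace CategoryTheory.ProjectiveResolution

variable {C : Type*} [Category C] [Abelian C] {D : Type*} [Category D] [Abelian D]

theorem mapHomologicalComplex_d_eq_zero {X : C} (P : ProjectiveResolution X) (F : C ⥤ D)
    [F.Additive] {i j : ℕ} (h : P.complex.d i j = 0) :
    ((F.mapHomologicalComplex _).obj P.complex).d i j = 0 := by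
  rw [Functor.mapHomologicalComplex_obj_d, h, F.map_zero]
  rfl

variable [HasProjectiveResolutions C]

/-- The value of a left derived functor as a homology object. -/
def leftDerivedObjIsoHomology {X : C} (P : ProjectiveResolution X) (F : C ⥤ D) [F.Additive]
    (n : ℕ) : (F.leftDerived n).obj X ≅
      HomologicalComplex.homology ((F.mapHomologicalComplex _).obj P.complex) n :=
  P.isoLeftDerivedObj F n

theorem leftDerivedObjIsoHomology_naturality {X Y : C} (f : X ⟶ Y) (P : ProjectiveResolution X)
    (Q : ProjectiveResolution Y) (φ : P.complex ⟶ Q.complex)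
    (comm : φ.f 0 ≫ Q.π.f 0 = P.π.f 0 ≫ f) (F : C ⥤ D) [F.Additive] (n : ℕ) :
    (F.leftDerived n).map f ≫ (Q.leftDerivedObjIsoHomology F n).hom =
      (P.leftDerivedObjIsoHomology F n).hom ≫
        HomologicalComplex.homologyMap ((F.mapHomologicalComplex _).map φ) n :=
  isoLeftDerivedObj_hom_naturality f P Q φ comm F n

/-- The embedding of the `n`-th left derived functor into `F(Pₙ)` for a projective resolution `P`
with vanishing differential `Pₙ₊₁ ⟶ Pₙ`. -/
def leftDerivedToX {X : C} (P : ProjectiveResolution X) (F : C ⥤ D) [F.Additive] (n : ℕ)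
    (h : P.complex.d (n + 1) n = 0) :
    (F.leftDerived n).obj X ⟶ ((F.mapHomologicalComplex _).obj P.complex).X n :=
  (P.leftDerivedObjIsoHomology F n).hom ≫ HomologicalComplex.homologyToX n _
    (P.mapHomologicalComplex_d_eq_zero F h)

instance {X : C} (P : ProjectiveResolution X) (F : C ⥤ D) [F.Additive] (n : ℕ)
    (h : P.complex.d (n + 1) n = 0) : Mono (P.leftDerivedToX F n h) := by
  unfold leftDerivedToX
  infer_instance

theorem leftDerivedToX_naturality {X Y : C} (f : X ⟶ Y) (P : ProjectiveResolution X)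
    (Q : ProjectiveResolution Y) (φ : P.complex ⟶ Q.complex)
    (comm : φ.f 0 ≫ Q.π.f 0 = P.π.f 0 ≫ f) (F : C ⥤ D) [F.Additive] (n : ℕ)
    (hP : P.complex.d (n + 1) n = 0) (hQ : Q.complex.d (n + 1) n = 0) :
    (F.leftDerived n).map f ≫ Q.leftDerivedToX F n hQ =
      P.leftDerivedToX F n hP ≫ ((F.mapHomologicalComplex _).map φ).f n := by
  unfold leftDerivedToX
  rw [← Category.assoc, leftDerivedObjIsoHomology_naturality f P Q φ comm F n, Category.assoc,
    Category.assoc, HomologicalComplex.homologyToX_naturality]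

theorem leftDerivedToX_comp {X : C} (P : ProjectiveResolution X) (F : C ⥤ D) [F.Additive]
    (n : ℕ) (h : P.complex.d (n + 2) (n + 1) = 0) :
    P.leftDerivedToX F (n + 1) h ≫ ((F.mapHomologicalComplex _).obj P.complex).d (n + 1) n = 0 := by
  unfold leftDerivedToX
  rw [Category.assoc, HomologicalComplex.homologyToX_comp_d, comp_zero]

theorem leftDerivedToX_exact {X : C} (P : ProjectiveResolution X) (F : C ⥤ D) [F.Additive]
    (n : ℕ) (h : P.complex.d (n + 2) (n + 1) = 0) :
    (ShortComplex.mk _ _ (P.leftDerivedToX_comp F n h)).Exact := by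
  let e : ShortComplex.mk _ _ (P.leftDerivedToX_comp F n h) ≅
      ShortComplex.mk _ _ (HomologicalComplex.homologyToX_comp_d n
        (P.mapHomologicalComplex_d_eq_zero F h)) :=
    ShortComplex.isoMk (P.leftDerivedObjIsoHomology F (n + 1)) (Iso.refl _) (Iso.refl _)
      (by simp [leftDerivedToX])
      ((Category.id_comp _).trans (Category.comp_id _).symm)
  exact ShortComplex.exact_of_iso e.symm (HomologicalComplex.homologyToX_exact n _)

end CategoryTheory.ProjectiveResolution

end

noncomputable section

open CategoryTheory CategoryTheory.Limits Opposite

/-! ### Top-degree Ext as a quotient of a Hom module. -/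

section Ext

variable {R : Type u} [CommRing R] {X Y : ModuleCat.{u} R} (P : ProjectiveResolution X)
  (Q : ProjectiveResolution Y) (Z : ModuleCat.{u} R)

/-- The class in `Extⁿ(X, Z)` of a homomorphism `Pₙ ⟶ Z`, for a projective resolution `P` of `X`
with vanishing differential `Pₙ₊₁ ⟶ Pₙ`. -/
def extClass (n : ℕ) (h : P.complex.d (n + 1) n = 0) :
    (P.complex.X n ⟶ Z) →ₗ[R] ((Ext R (ModuleCat.{u} R) n).obj (op X)).obj Z :=
  ModuleCat.Hom.hom (P.leftDerivedToX ((linearYoneda R (ModuleCat.{u} R)).obj Z).rightOp n h).unop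

/-- Ext is a left derived functor with values in the opposite category, so the embedding
`leftDerivedToX` becomes an epimorphism of modules after `unop`. -/
theorem extClass_surjective (n : ℕ) (h : P.complex.d (n + 1) n = 0) :
    Function.Surjective (extClass P Z n h) :=
  (ModuleCat.epi_iff_surjective
    (P.leftDerivedToX ((linearYoneda R (ModuleCat.{u} R)).obj Z).rightOp n h).unop).mp
    inferInstance

theorem extClass_eq_zero_iff (n : ℕ) (h : P.complex.d (n + 2) (n + 1) = 0)
    (f : P.complex.X (n + 1) ⟶ Z) :
    extClass P Z (n + 1) h f = 0 ↔ ∃ g : P.complex.X n ⟶ Z, P.complex.d (n + 1) n ≫ g = f := by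
  have hex := (P.leftDerivedToX_exact ((linearYoneda R (ModuleCat.{u} R)).obj Z).rightOp n h).unop
  constructor
  · intro hf
    exact (ShortComplex.moduleCat_exact_iff _).mp hex f hf
  · rintro ⟨g, rfl⟩
    exact ShortComplex.moduleCat_zero_apply (ShortComplex.mk _ _ (P.leftDerivedToX_comp
      ((linearYoneda R (ModuleCat.{u} R)).obj Z).rightOp n h)).unop g

theorem extClass_naturality (f : X ⟶ Y) (φ : P.complex ⟶ Q.complex)
    (comm : φ.f 0 ≫ Q.π.f 0 = P.π.f 0 ≫ f) (n : ℕ)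
    (hP : P.complex.d (n + 1) n = 0) (hQ : Q.complex.d (n + 1) n = 0) (g : Q.complex.X n ⟶ Z) :
    ((Ext R (ModuleCat.{u} R) n).map f.op).app Z (extClass Q Z n hQ g) =
      extClass P Z n hP (φ.f n ≫ g) := by
  have := congrArg Quiver.Hom.unop (ProjectiveResolution.leftDerivedToX_naturality f P Q φ comm
    ((linearYoneda R (ModuleCat.{u} R)).obj Z).rightOp n hP hQ)
  exact congrArg (fun l => ModuleCat.Hom.hom l g) this

end Ext

/-! ### The Koszul resolution on two elements and the resulting Ext² classes. -/

section Koszul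

variable {R : Type u} [CommRing R]

/-- The differential `(u, v) ↦ a u + b v` of the Koszul complex. -/
def koszulD₁ (a b : R) : (R × R) →ₗ[R] R :=
  (LinearMap.mulLeft R a).coprod (LinearMap.mulLeft R b)

/-- The differential `r ↦ (-b r, a r)` of the Koszul complex. -/
def koszulD₂ (a b : R) : R →ₗ[R] (R × R) :=
  (LinearMap.mulLeft R (-b)).prod (LinearMap.mulLeft R a)

variable (R) in
/-- The modules of the Koszul complex on two elements. -/
def koszulX : ℕ → ModuleCat.{u} R
  | 0 => ModuleCat.of R R
  | 1 => ModuleCat.of R (R × R)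
  | 2 => ModuleCat.of R R
  | _ + 3 => ModuleCat.of R PUnit.{u + 1}

/-- The differentials of the Koszul complex on two elements. -/
def koszulD (a b : R) : ∀ n, koszulX R (n + 1) ⟶ koszulX R n
  | 0 => ModuleCat.ofHom (koszulD₁ a b)
  | 1 => ModuleCat.ofHom (koszulD₂ a b)
  | _ + 2 => 0

theorem koszulD₁_koszulD₂ (a b r : R) : koszulD₁ a b (koszulD₂ a b r) = 0 := by
  simp [koszulD₁, koszulD₂]
  ring

theorem koszulD_comp (a b : R) : ∀ n, koszulD a b (n + 1) ≫ koszulD a b n = 0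
  | 0 => ModuleCat.hom_ext (LinearMap.ext fun r => koszulD₁_koszulD₂ a b r)
  | 1 => zero_comp
  | _ + 2 => zero_comp

/-- The Koszul complex on two elements. -/
def koszulComplex (a b : R) : ChainComplex (ModuleCat.{u} R) ℕ :=
  ChainComplex.of (koszulX R) (koszulD a b) (koszulD_comp a b)

theorem koszulComplex_d (a b : R) (n : ℕ) :
    (koszulComplex a b).d (n + 1) n = koszulD a b n :=
  ChainComplex.of_d _ _ _

instance koszulComplex_projective (a b : R) (n : ℕ) :
    Projective ((koszulComplex a b).X n) := by
  rw [← IsProjective.iff_projective]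
  obtain _ | _ | _ | n := n
  · exact inferInstanceAs (Module.Projective R R)
  · exact inferInstanceAs (Module.Projective R (R × R))
  · exact inferInstanceAs (Module.Projective R R)
  · exact inferInstanceAs (Module.Projective R PUnit.{u + 1})

/-- The pair `a, b` is weakly regular on the ring. -/
structure IsKoszulRegular (a b : R) : Prop where
  left : ∀ r, a * r = 0 → r = 0
  right : ∀ r s, b * r = a * s → ∃ q, r = a * q

theorem koszulComplex_exactAt_succ {a b : R} (h : IsKoszulRegular a b) (n : ℕ) :
    (koszulComplex a b).ExactAt (n + 1) := by
  rw [HomologicalComplex.exactAt_iff' _ (n + 2) (n + 1) n (by simp) (by simp),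
    ShortComplex.moduleCat_exact_iff]
  intro x hx
  change (koszulComplex a b).d (n + 1) n x = 0 at hx
  change ∃ y, (koszulComplex a b).d (n + 2) (n + 1) y = x
  rw [koszulComplex_d] at hx
  simp only [koszulComplex_d]
  match n with
  | 0 =>
    obtain ⟨p, q⟩ : R × R := x
    have hx' : a * p + b * q = 0 := hx
    -- A cycle satisfies b q = a (-p), so regularity of b modulo a gives q = a r; cancelling a then
    -- forces p = -b r.
    obtain ⟨r, rfl⟩ := h.right q (-p) (by linear_combination hx')
    have hp : p = -b * r := by
      have := h.left (p + b * r) (by linear_combination hx')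
      linear_combination this
    exact ⟨(r : R), Prod.ext hp.symm rfl⟩
  | 1 =>
    refine ⟨PUnit.unit, ?_⟩
    have hx' : a * (show R from x) = 0 := congrArg (fun z : R × R => z.2) hx
    exact (h.left _ hx').symm
  | n + 2 => exact ⟨PUnit.unit, rfl⟩

/-- The augmentation of the Koszul complex. -/
def koszulAugmentation (a b : R) :
    (koszulComplex a b).X 0 ⟶ ModuleCat.of R (R ⧸ Ideal.span {a, b}) :=
  ModuleCat.ofHom (Submodule.mkQ (Ideal.span {a, b}))

theorem koszulComplex_d_augmentation (a b : R) :
    (koszulComplex a b).d 1 0 ≫ koszulAugmentation a b = 0 := by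
  rw [koszulComplex_d]
  refine ModuleCat.hom_ext (LinearMap.ext fun (x : R × R) => ?_)
  refine (Submodule.Quotient.mk_eq_zero _).mpr ?_
  exact Ideal.mem_span_pair.mpr ⟨x.1, x.2, by
    change x.1 * a + x.2 * b = a * x.1 + b * x.2
    ring⟩

theorem koszul_exact_augmentation (a b : R) :
    (ShortComplex.mk _ _ (koszulComplex_d_augmentation a b)).Exact := by
  rw [ShortComplex.moduleCat_exact_iff]
  intro x hx
  change ∃ y, (koszulComplex a b).d 1 0 y = x
  rw [koszulComplex_d]
  obtain ⟨p, q, hpq⟩ := Ideal.mem_span_pair.mp ((Submodule.Quotient.mk_eq_zero _).mp hx)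
  refine ⟨((p, q) : R × R), Eq.trans ?_ hpq⟩
  change a * p + b * q = _
  ring

/-- The Koszul resolution of `R ⧸ (a, b)`. -/
def koszulResolution {a b : R} (h : IsKoszulRegular a b) :
    ProjectiveResolution (ModuleCat.of R (R ⧸ Ideal.span {a, b})) where
  complex := koszulComplex a b
  π := (ChainComplex.toSingle₀Equiv _ _).symm
    ⟨koszulAugmentation a b, koszulComplex_d_augmentation a b⟩
  quasiIso := ⟨fun n => by
    cases n
    · rw [ChainComplex.quasiIsoAt₀_iff, ShortComplex.quasiIso_iff_of_zeros']
      · refine (ShortComplex.exact_and_epi_g_iff_of_iso ?_).2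
          ⟨koszul_exact_augmentation a b, (ModuleCat.epi_iff_surjective _).mpr
            (Submodule.mkQ_surjective _)⟩
        exact ShortComplex.isoMk (Iso.refl _) (Iso.refl _) (Iso.refl _)
          ((Category.id_comp _).trans (Category.comp_id _).symm)
          ((Category.id_comp _).trans (Category.comp_id _).symm)
      all_goals rfl
    · rw [quasiIsoAt_iff_exactAt']
      · exact koszulComplex_exactAt_succ h _
      · apply ChainComplex.exactAt_succ_single_obj⟩

/-- The components of the chain map lifting `R ⧸ (a c, b d) ⟶ R ⧸ (a, b)`. -/
def koszulMapX (c d : R) : ∀ n, koszulX R n ⟶ koszulX R n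
  | 0 => 𝟙 _
  | 1 => ModuleCat.ofHom ((LinearMap.mulLeft R c).prodMap (LinearMap.mulLeft R d))
  | 2 => ModuleCat.ofHom (LinearMap.mulLeft R (c * d))
  | _ + 3 => 0

theorem koszulMapX_comm (a b c d : R) : ∀ n,
    koszulMapX c d (n + 1) ≫ koszulD a b n = koszulD (a * c) (b * d) n ≫ koszulMapX c d n
  | 0 => by
    refine ModuleCat.hom_ext (LinearMap.ext fun (x : R × R) => ?_)
    change a * (c * x.1) + b * (d * x.2) = a * c * x.1 + b * d * x.2
    ring
  | 1 => by
    refine ModuleCat.hom_ext (LinearMap.ext fun (x : R) => Prod.ext ?_ ?_)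
    · change -b * (c * d * x) = c * (-(b * d) * x)
      ring
    · change a * (c * d * x) = d * (a * c * x)
      ring
  | _ + 2 => (comp_zero).trans zero_comp.symm

/-- The chain map of Koszul complexes lifting `R ⧸ (a c, b d) ⟶ R ⧸ (a, b)`. -/
def koszulMap (a b c d : R) : koszulComplex (a * c) (b * d) ⟶ koszulComplex a b :=
  ChainComplex.ofHom (koszulMapX c d) fun n => by
    rw [koszulComplex_d, koszulComplex_d]
    exact koszulMapX_comm a b c d n

/-- The class in `Ext²(R ⧸ (a, b), R)` of an element of `R`. -/
def koszulClass {a b : R} (h : IsKoszulRegular a b) : R →ₗ[R]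
    ((Ext R (ModuleCat.{u} R) 2).obj (op (ModuleCat.of R (R ⧸ Ideal.span {a, b})))).obj
      (ModuleCat.of R R) :=
  extClass (koszulResolution h) (ModuleCat.of R R) 2 (koszulComplex_d a b 2) ∘ₗ
    { toFun := fun r => ModuleCat.ofHom (LinearMap.mulLeft R r)
      map_add' := fun r s => by
        refine ModuleCat.hom_ext (LinearMap.ext fun (x : R) => ?_)
        exact add_mul r s x
      map_smul' := fun r s => by
        refine ModuleCat.hom_ext (LinearMap.ext fun (x : R) => ?_)
        exact mul_assoc r s x }

theorem koszulClass_surjective {a b : R} (h : IsKoszulRegular a b) :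
    Function.Surjective (koszulClass h) := by
  intro z
  obtain ⟨f, rfl⟩ := extClass_surjective (koszulResolution h) (ModuleCat.of R R) 2
    (koszulComplex_d a b 2) z
  refine ⟨ModuleCat.Hom.hom f (1 : R), congrArg (extClass (koszulResolution h) (ModuleCat.of R R) 2
    (koszulComplex_d a b 2)) ?_⟩
  refine ModuleCat.hom_ext (LinearMap.ext fun (x : R) => ?_)
  let g : R →ₗ[R] R := ModuleCat.Hom.hom f
  change g 1 * x = g x
  simpa [mul_comm] using (g.map_smul x 1).symm

/-- Self-duality of the Koszul complex: the maps R → R that factor through r ↦ (-b r, a r) are the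
multiplications by elements of (a, b). Hence Ext²(R/(a, b), R) is R/(a, b). -/
theorem koszulClass_eq_zero_iff {a b : R} (h : IsKoszulRegular a b) (r : R) :
    koszulClass h r = 0 ↔ r ∈ Ideal.span {a, b} := by
  have hd : (koszulResolution h).complex.d 2 1 = ModuleCat.ofHom (koszulD₂ a b) :=
    koszulComplex_d a b 1
  refine (extClass_eq_zero_iff (koszulResolution h) (ModuleCat.of R R) 1 (koszulComplex_d a b 2)
    (ModuleCat.ofHom (LinearMap.mulLeft R r))).trans ?_
  rw [hd, Ideal.mem_span_pair]
  constructor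
  · rintro ⟨g, hg⟩
    let g' : (R × R) →ₗ[R] R := ModuleCat.Hom.hom g
    have h1 : g' (koszulD₂ a b 1) = r * 1 :=
      congrArg (fun l => ModuleCat.Hom.hom l (1 : R)) hg
    have h2 : koszulD₂ a b 1 = (-b) • (1, 0) + a • (0, 1) := by simp [koszulD₂]
    rw [h2, map_add, map_smul, map_smul, smul_eq_mul, smul_eq_mul] at h1
    exact ⟨g' (0, 1), -g' (1, 0), by linear_combination h1⟩
  · rintro ⟨p, q, rfl⟩
    refine ⟨ModuleCat.ofHom (koszulD₁ (-q) p), ?_⟩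
    refine ModuleCat.hom_ext (LinearMap.ext fun (x : R) => ?_)
    change -q * (-b * x) + p * (a * x) = (p * a + q * b) * x
    ring

/-- The projection lifts to a map of Koszul complexes that is multiplication by c d in degree 2;
this is where the transition maps of local cohomology come from. -/
theorem koszulClass_naturality {a b c d : R} (h : IsKoszulRegular a b)
    (h' : IsKoszulRegular (a * c) (b * d))
    (f : ModuleCat.of R (R ⧸ Ideal.span {a * c, b * d}) ⟶ ModuleCat.of R (R ⧸ Ideal.span {a, b}))
    (hf : ∀ r : R, f (Submodule.Quotient.mk r) = Submodule.Quotient.mk r) (r : R) :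
    ((Ext R (ModuleCat.{u} R) 2).map f.op).app (ModuleCat.of R R) (koszulClass h r) =
      koszulClass h' (c * d * r) := by
  refine (extClass_naturality (koszulResolution h') (koszulResolution h) (ModuleCat.of R R) f
    (koszulMap a b c d) ?_ 2 (koszulComplex_d _ _ 2) (koszulComplex_d a b 2) _).trans ?_
  · have h1 : (koszulResolution h).π.f 0 = koszulAugmentation a b :=
      ChainComplex.toSingle₀Equiv_symm_apply_f_zero _ _
    have h2 : (koszulResolution h').π.f 0 = koszulAugmentation (a * c) (b * d) :=
      ChainComplex.toSingle₀Equiv_symm_apply_f_zero _ _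
    rw [h1, h2]
    refine ModuleCat.hom_ext (LinearMap.ext fun (x : R) => ?_)
    exact (hf x).symm
  · refine congrArg (extClass (koszulResolution h') (ModuleCat.of R R) 2 _) ?_
    refine ModuleCat.hom_ext (LinearMap.ext fun (x : R) => ?_)
    change r * (c * d * x) = c * d * r * x
    ring

end Koszul

end

noncomputable section

open CategoryTheory CategoryTheory.Limits Opposite

/-! ### Second local cohomology as a colimit over powers of two elements. -/

section LocalCohomology

open localCohomology

variable {R : Type u} [CommRing R]

/-- The diagram of the ideals `(aᵗ⁺¹, bᵗ⁺¹)`. -/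
def pairPowersDiagram (a b : R) : ℕᵒᵖ ⥤ Ideal R where
  obj t := Ideal.span {a ^ (unop t + 1), b ^ (unop t + 1)}
  map {s t} w := ⟨⟨by
    have h : unop t ≤ unop s := leOfHom w.unop
    rw [Ideal.span_le]
    rintro x (rfl | rfl)
    · exact Ideal.mem_of_dvd _ (pow_dvd_pow a (Nat.succ_le_succ h))
        (Ideal.subset_span (Set.mem_insert _ _))
    · exact Ideal.mem_of_dvd _ (pow_dvd_pow b (Nat.succ_le_succ h))
        (Ideal.subset_span (Set.mem_insert_of_mem _ rfl))⟩⟩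

/-- The diagram of the ideals `(aᵗ⁺¹, bᵗ⁺¹)` among the ideals whose radical contains `J`. -/
def pairPowersToSelfLERadical (a b : R) (J : Ideal R)
    (hJ : ∀ t, J ≤ (Ideal.span {a ^ (t + 1), b ^ (t + 1)}).radical) : ℕᵒᵖ ⥤ SelfLERadical J :=
  ObjectProperty.lift _ (pairPowersDiagram a b) fun t => hJ (unop t)

/-- An ideal whose radical contains J contains some a^m and b^n, hence a member of the family. Two
such members are always comparable, which gives connectedness. -/
theorem pairPowersToSelfLERadical_initial (a b : R) (J : Ideal R)
    (hJ : ∀ t, J ≤ (Ideal.span {a ^ (t + 1), b ^ (t + 1)}).radical) (ha : a ∈ J) (hb : b ∈ J) :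
    (pairPowersToSelfLERadical a b J hJ).Initial where
  out J' := by
    apply +allowSynthFailures zigzag_isConnected
    · obtain ⟨m, hm⟩ := J'.2 ha
      obtain ⟨n, hn⟩ := J'.2 hb
      refine ⟨CostructuredArrow.mk (Y := op (max m n)) (⟨⟨⟨?_⟩⟩⟩ :
        (pairPowersToSelfLERadical a b J hJ).obj (op (max m n)) ⟶ J')⟩
      change Ideal.span {a ^ (max m n + 1), b ^ (max m n + 1)} ≤ J'.1
      rw [Ideal.span_le]
      rintro x (rfl | rfl)
      · exact Ideal.pow_mem_of_pow_mem _ hm (by omega)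
      · exact Ideal.pow_mem_of_pow_mem _ hn (by omega)
    · intro j1 j2
      apply Relation.ReflTransGen.single
      rcases le_total (unop j1.left) (unop j2.left) with h | h
      · right; exact ⟨CostructuredArrow.homMk (homOfLE h).op rfl⟩
      · left; exact ⟨CostructuredArrow.homMk (homOfLE h).op rfl⟩

/-- Local cohomology is computed by the ideals `(aᵗ⁺¹, bᵗ⁺¹)`. -/
def isoPairPowers [IsNoetherianRing R] (a b : R) (J : Ideal R)
    (hJ : ∀ t, J ≤ (Ideal.span {a ^ (t + 1), b ^ (t + 1)}).radical) (ha : a ∈ J) (hb : b ∈ J)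
    (i : ℕ) : ofDiagram.{u, 0} (pairPowersDiagram a b) i ≅ localCohomology.{u} J i :=
  have := pairPowersToSelfLERadical_initial a b J hJ ha hb
  HasColimit.isoOfNatIso.{0, 0, u + 1, u + 1} (Iso.refl.{u + 1, u + 1} _) ≪≫
    localCohomology.isoOfFinal.{u, u, 0} (pairPowersToSelfLERadical.{u} a b J hJ)
      (selfLERadicalDiagram.{u} J) i ≪≫ isoSelfLERadical J i

/-- The directed system of the modules `Ext²(R ⧸ (aᵗ⁺¹, bᵗ⁺¹), R)`. -/
def pairPowersExt (a b : R) : ℕᵒᵖᵒᵖ ⥤ ModuleCat.{u} R :=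
  diagram (pairPowersDiagram a b) 2 ⋙ (evaluation _ _).obj (ModuleCat.of R R)

/-- The module `H²_J(R)` as a cocone over the modules `Ext²(R ⧸ (aᵗ⁺¹, bᵗ⁺¹), R)`. -/
def pairPowersCocone (a b : R) : Cocone (pairPowersExt a b) :=
  ((evaluation _ _).obj (ModuleCat.of R R)).mapCocone
    (colimit.cocone (diagram (pairPowersDiagram a b) 2))

/-- `H²_J(R)` is the colimit of the modules `Ext²(R ⧸ (aᵗ⁺¹, bᵗ⁺¹), R)`. -/
def pairPowersCoconeIsColimit (a b : R) : IsColimit (pairPowersCocone a b) :=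
  isColimitOfPreserves _ (colimit.isColimit _)

instance preservesColimitsOfShape_forget_moduleCat :
    PreservesColimitsOfShape ℕᵒᵖᵒᵖ (forget (ModuleCat.{u} R)) :=
  have := preservesSmallestFilteredColimits_of_preservesFilteredColimits (forget (ModuleCat.{u} R))
  PreservesFilteredColimitsOfSize.preserves_filtered_colimits _

theorem pairPowersCocone_exists_rep (a b : R) (x : (pairPowersCocone a b).pt) :
    ∃ (t : ℕ) (y : (pairPowersExt a b).obj (op (op t))),
      (pairPowersCocone a b).ι.app (op (op t)) y = x := by
  obtain ⟨j, y, h⟩ := Concrete.isColimit_exists_rep _ (pairPowersCoconeIsColimit a b) x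
  exact ⟨unop (unop j), y, h⟩

theorem pairPowersCocone_eq_zero (a b : R) (t : ℕ) (y : (pairPowersExt a b).obj (op (op t)))
    (h : (pairPowersCocone a b).ι.app (op (op t)) y = 0) :
    ∃ (s : ℕ) (f : t ⟶ s), (pairPowersExt a b).map f.op.op y = 0 := by
  rw [← map_zero (ModuleCat.Hom.hom ((pairPowersCocone a b).ι.app (op (op t))))] at h
  obtain ⟨k, f, g, hfg⟩ :=
    (Concrete.isColimit_rep_eq_iff_exists _ (pairPowersCoconeIsColimit a b) y 0).mp h
  refine ⟨unop (unop k), f.unop.unop, ?_⟩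
  exact hfg.trans (map_zero (ModuleCat.Hom.hom ((pairPowersExt a b).map g)))

/-- The second local cohomology is the union of the images of the quotients `R ⧸ (aᵗ⁺¹, bᵗ⁺¹)`, with
transition maps the multiplication by `a b`. -/
theorem exists_localCohomology_two_classes [IsNoetherianRing R] (a b : R) (J : Ideal R)
    (hJ : ∀ t, J ≤ (Ideal.span {a ^ (t + 1), b ^ (t + 1)}).radical) (ha : a ∈ J) (hb : b ∈ J)
    (hreg : ∀ t, IsKoszulRegular (a ^ (t + 1)) (b ^ (t + 1))) :
    ∃ π : ℕ → R →ₗ[R] (localCohomology J 2).obj (ModuleCat.of R R),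
      (∀ z, ∃ t r, π t r = z) ∧
      (∀ t r, π (t + 1) (a * b * r) = π t r) ∧
      (∀ t r, π t r = 0 →
        ∃ s, (a * b) ^ s * r ∈ Ideal.span {a ^ (t + s + 1), b ^ (t + s + 1)}) ∧
      (∀ t, ∀ r ∈ Ideal.span {a ^ (t + 1), b ^ (t + 1)}, π t r = 0) := by
  let F := pairPowersExt a b
  let c := pairPowersCocone a b
  let κ : ∀ t : ℕ, R →ₗ[R] F.obj (op (op t)) := fun t => koszulClass (hreg t)
  have hκ : ∀ (t s : ℕ) (f : t ⟶ t + s) (r : R),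
      F.map f.op.op (κ t r) = κ (t + s) ((a * b) ^ s * r) := by
    intro t s f r
    have h1 : a ^ (t + s + 1) = a ^ (t + 1) * a ^ s := by ring
    have h2 : b ^ (t + s + 1) = b ^ (t + 1) * b ^ s := by ring
    -- The powers at level t + s equal a^(t+1) a^s and b^(t+1) b^s only propositionally, and they
    -- occur inside types; generalizing them allows the substitution.
    have key : ∀ (a' b' : R) (h' : IsKoszulRegular a' b'),
        a' = a ^ (t + 1) * a ^ s → b' = b ^ (t + 1) * b ^ s →
        ∀ g : ModuleCat.of R (R ⧸ Ideal.span {a', b'}) ⟶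
          ModuleCat.of R (R ⧸ Ideal.span {a ^ (t + 1), b ^ (t + 1)}),
        (∀ r : R, g (Submodule.Quotient.mk r) = Submodule.Quotient.mk r) →
        ((Ext R (ModuleCat.{u} R) 2).map g.op).app (ModuleCat.of R R) (koszulClass (hreg t) r) =
          koszulClass h' ((a * b) ^ s * r) := by
      rintro a' b' h' rfl rfl g hg
      rw [koszulClass_naturality (hreg t) h' g hg r, mul_pow]
    exact key _ _ (hreg (t + s)) h1 h2 ((ringModIdeals (pairPowersDiagram a b)).map f.op)
      (fun r => rfl)
  let e : c.pt ≅ (localCohomology J 2).obj (ModuleCat.of R R) :=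
    (isoPairPowers a b J hJ ha hb 2).app (ModuleCat.of R R)
  let e' : c.pt ≃ₗ[R] (localCohomology J 2).obj (ModuleCat.of R R) := e.toLinearEquiv
  refine ⟨fun t => e'.toLinearMap ∘ₗ ModuleCat.Hom.hom (c.ι.app (op (op t))) ∘ₗ κ t,
    fun z => ?_, fun t r => ?_, fun t r h => ?_, fun t r h => ?_⟩
  · obtain ⟨t, y, hy⟩ := pairPowersCocone_exists_rep a b (e'.symm z)
    obtain ⟨r, hr⟩ := koszulClass_surjective (hreg t) y
    refine ⟨t, r, ?_⟩
    rw [← e'.apply_symm_apply z, ← hy, ← hr]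
    rfl
  · refine congrArg e' ?_
    have h1 := hκ t 1 (homOfLE (Nat.le_succ t)) r
    rw [pow_one] at h1
    change c.ι.app (op (op (t + 1))) (κ (t + 1) (a * b * r)) = c.ι.app (op (op t)) (κ t r)
    rw [← h1, ← ConcreteCategory.comp_apply, c.w]
  · have h0 : c.ι.app (op (op t)) (κ t r) = 0 := e'.map_eq_zero_iff.mp h
    obtain ⟨s, f, hs⟩ := pairPowersCocone_eq_zero a b t (κ t r) h0
    obtain ⟨s, rfl⟩ := Nat.exists_eq_add_of_le (leOfHom f)
    exact ⟨s, (koszulClass_eq_zero_iff (hreg (t + s)) _).mp ((hκ t s f r).symm.trans hs)⟩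
  · have h0 : κ t r = 0 := (koszulClass_eq_zero_iff (hreg t) r).mpr h
    simp [h0]

end LocalCohomology

end

noncomputable section

/-! ### Division of power series by finitely many monomials. -/

section MonomialDivision

open MvPowerSeries

/-- A power series, each of whose monomials is divisible by a monomial with exponent in `T`, is a
combination of these monomials. -/
theorem MvPowerSeries.exists_eq_sum_monomial_mul {σ k : Type*} [CommRing k]
    (T : Finset (σ →₀ ℕ)) (f : MvPowerSeries σ k)
    (h : ∀ e, coeff e f ≠ 0 → ∃ w ∈ T, w ≤ e) :
    ∃ g : (σ →₀ ℕ) → MvPowerSeries σ k, f = ∑ w ∈ T, monomial w 1 * g w ∧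
      ∀ w e, coeff e (g w) ≠ 0 → coeff (w + e) f ≠ 0 := by
  classical
  choose! c hcT hce using h
  -- Each exponent e of `f` is assigned to a single divisor `c e`, so that its coefficient enters
  -- exactly one quotient.
  let g : (σ →₀ ℕ) → MvPowerSeries σ k := fun w e =>
    if c (w + e) = w then coeff (w + e) f else 0
  have hg : ∀ w e, coeff e (g w) = if c (w + e) = w then coeff (w + e) f else 0 :=
    fun _ _ => rfl
  refine ⟨g, ?_, fun w e hwe h0 => hwe (by rw [hg, h0, ite_self])⟩
  ext e
  rw [map_sum]
  by_cases he : coeff e f = 0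
  · rw [he, eq_comm]
    refine Finset.sum_eq_zero fun w _ => ?_
    rw [coeff_monomial_mul]
    split_ifs with hw
    · rw [hg, add_tsub_cancel_of_le hw, he, ite_self, mul_zero]
    · rfl
  · rw [Finset.sum_eq_single (c e)]
    · rw [coeff_monomial_mul, if_pos (hce e he), hg, add_tsub_cancel_of_le (hce e he), if_pos rfl,
        one_mul]
    · intro w _ hw
      rw [coeff_monomial_mul]
      split_ifs with hwe
      · rw [hg, add_tsub_cancel_of_le hwe, if_neg (Ne.symm hw), mul_zero]
      · rfl
    · exact fun hn => absurd (hcT e he) hn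

theorem MvPowerSeries.exists_of_coeff_mul_ne_zero {σ k : Type*} [CommRing k]
    {f g : MvPowerSeries σ k} {e : σ →₀ ℕ} (h : coeff e (f * g) ≠ 0) :
    ∃ p q, p + q = e ∧ coeff p f ≠ 0 ∧ coeff q g ≠ 0 := by
  classical
  rw [coeff_mul] at h
  obtain ⟨x, hx, hne⟩ := Finset.exists_ne_zero_of_sum_ne_zero h
  exact ⟨x.1, x.2, Finset.HasAntidiagonal.mem_antidiagonal.mp hx, left_ne_zero_of_mul hne,
    right_ne_zero_of_mul hne⟩

end MonomialDivision

/-! ### Exponents in two variables. -/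

section Exponents

theorem Finsupp.degree_fin_two (e : Fin 2 →₀ ℕ) : e.degree = e 0 + e 1 := by
  rw [Finsupp.degree_eq_sum, Fin.sum_univ_two]

theorem Finsupp.le_fin_two {e e' : Fin 2 →₀ ℕ} : e ≤ e' ↔ e 0 ≤ e' 0 ∧ e 1 ≤ e' 1 := by
  rw [Finsupp.le_def, Fin.forall_fin_two]

/-- The exponent of `x ^ p * y ^ q`. -/
def pairExp (p q : ℕ) : Fin 2 →₀ ℕ := Finsupp.single 0 p + Finsupp.single 1 q

@[simp] theorem pairExp_zero (p q : ℕ) : pairExp p q 0 = p := by simp [pairExp]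

@[simp] theorem pairExp_one (p q : ℕ) : pairExp p q 1 = q := by simp [pairExp]

@[simp] theorem degree_pairExp (p q : ℕ) : (pairExp p q).degree = p + q := by
  rw [Finsupp.degree_fin_two, pairExp_zero, pairExp_one]

theorem eq_pairExp (e : Fin 2 →₀ ℕ) : e = pairExp (e 0) (e 1) := by
  ext i
  fin_cases i <;> simp

theorem pairExp_add (p q p' q' : ℕ) :
    pairExp p q + pairExp p' q' = pairExp (p + p') (q + q') := by
  ext i
  fin_cases i <;> simp

theorem X_pow_mul_X_pow_eq_monomial {k : Type*} [CommRing k] (p q : ℕ) :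
    (MvPowerSeries.X 0 ^ p * MvPowerSeries.X 1 ^ q : MvPowerSeries (Fin 2) k) =
      MvPowerSeries.monomial (pairExp p q) 1 := by
  rw [MvPowerSeries.X_pow_eq, MvPowerSeries.X_pow_eq, MvPowerSeries.monomial_mul_monomial,
    one_mul, pairExp]

/-- The exponents of degree `n`. -/
def degreeExps (n : ℕ) : Finset (Fin 2 →₀ ℕ) :=
  (Finset.range (n + 1)).image fun j => pairExp (n - j) j

theorem mem_degreeExps {n : ℕ} {e : Fin 2 →₀ ℕ} : e ∈ degreeExps n ↔ e.degree = n := by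
  simp only [degreeExps, Finset.mem_image, Finset.mem_range]
  constructor
  · rintro ⟨j, hj, rfl⟩
    rw [degree_pairExp]
    omega
  · intro h
    rw [Finsupp.degree_fin_two] at h
    refine ⟨e 1, by omega, ?_⟩
    rw [← h, Nat.add_sub_cancel, ← eq_pairExp]

theorem exists_le_of_le_degree {n : ℕ} {e : Fin 2 →₀ ℕ} (h : n ≤ e.degree) :
    ∃ w ∈ degreeExps n, w ≤ e := by
  rw [Finsupp.degree_fin_two] at h
  refine ⟨pairExp (n - min n (e 1)) (min n (e 1)), ?_, ?_⟩
  · rw [mem_degreeExps, degree_pairExp]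
    omega
  · rw [Finsupp.le_fin_two, pairExp_zero, pairExp_one]
    omega

end Exponents

/-! ### The decomposition of k[[x,y]] by degree modulo d. -/

section GradedPart

open MvPowerSeries

variable {k : Type u} [Field k] {d : ℕ}

theorem mem_veronese_iff {f : MvPowerSeries (Fin 2) k} :
    f ∈ veronese k d ↔ ∀ e, coeff e f ≠ 0 → d ∣ e.degree := by
  rw [mem_veronese]
  exact forall_congr' fun e => not_imp_comm

theorem monomial_mem_veronese {w : Fin 2 →₀ ℕ} (h : d ∣ w.degree) :
    (monomial w 1 : MvPowerSeries (Fin 2) k) ∈ veronese k d := by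
  classical
  rw [mem_veronese]
  intro e he
  rw [coeff_monomial, if_neg]
  rintro rfl
  exact he h

variable (k d) in
/-- The power series all of whose monomials have degree congruent to `i` modulo `d`. -/
def gradedPart (i : ℕ) : Submodule (veronese k d) (MvPowerSeries (Fin 2) k) where
  carrier := {f | ∀ e, coeff e f ≠ 0 → e.degree ≡ i [MOD d]}
  zero_mem' := fun e he => absurd (map_zero _) he
  add_mem' := fun {f g} hf hg e he => by
    by_cases h : coeff e f = 0
    · refine hg e fun h' => he ?_
      rw [map_add, h, h', add_zero]
    · exact hf e h
  smul_mem' := fun r f hf e he => by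
    obtain ⟨p, q, rfl, hp, hq⟩ := exists_of_coeff_mul_ne_zero he
    rw [map_add]
    simpa using ((Nat.modEq_zero_iff_dvd.mpr (mem_veronese_iff.mp r.2 p hp)).add (hf q hq))

theorem mem_gradedPart {i : ℕ} {f : MvPowerSeries (Fin 2) k} :
    f ∈ gradedPart k d i ↔ ∀ e, coeff e f ≠ 0 → e.degree ≡ i [MOD d] := Iff.rfl

theorem mul_mem_gradedPart {i j : ℕ} {f g : MvPowerSeries (Fin 2) k} (hf : f ∈ gradedPart k d i)
    (hg : g ∈ gradedPart k d j) : f * g ∈ gradedPart k d (i + j) := by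
  intro e he
  obtain ⟨p, q, rfl, hp, hq⟩ := exists_of_coeff_mul_ne_zero he
  rw [map_add]
  exact (hf p hp).add (hg q hq)

theorem monomial_mem_gradedPart {i : ℕ} {w : Fin 2 →₀ ℕ} (h : w.degree ≡ i [MOD d]) :
    (monomial w 1 : MvPowerSeries (Fin 2) k) ∈ gradedPart k d i := by
  classical
  intro e he
  rw [coeff_monomial] at he
  rwa [of_not_not fun h' : ¬ e = w => he (if_neg h')]

theorem mem_gradedPart_zero {f : MvPowerSeries (Fin 2) k} :
    f ∈ gradedPart k d 0 ↔ f ∈ veronese k d := by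
  rw [mem_veronese_iff, mem_gradedPart]
  simp only [Nat.modEq_zero_iff_dvd]

/-- Division with remainder classes: the quotients of a decomposition along monomials of the
same class are homogeneous modulo `d`. -/
theorem exists_eq_sum_monomial_mul_of_mem_gradedPart {i j : ℕ} (T : Finset (Fin 2 →₀ ℕ))
    {f : MvPowerSeries (Fin 2) k} (hf : f ∈ gradedPart k d (j + i))
    (hT : ∀ w ∈ T, w.degree ≡ j [MOD d]) (h : ∀ e, coeff e f ≠ 0 → ∃ w ∈ T, w ≤ e) :
    ∃ g : (Fin 2 →₀ ℕ) → MvPowerSeries (Fin 2) k, f = ∑ w ∈ T, monomial w 1 * g w ∧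
      ∀ w ∈ T, g w ∈ gradedPart k d i := by
  obtain ⟨g, hfg, hg⟩ := exists_eq_sum_monomial_mul T f h
  refine ⟨g, hfg, fun w hw e he => ?_⟩
  have := hf _ (hg w e he)
  rw [map_add] at this
  exact Nat.ModEq.add_left_cancel (hT w hw) this

/-- Because i < d, a degree congruent to i is at least i, so every such monomial is divisible by one
of degree exactly i, with quotient in R. This turns membership in M_i into a condition on exponents.
-/
theorem veroneseModule_eq_gradedPart {i : ℕ} (hi : i < d) :
    veroneseModule k d i = gradedPart k d i := by
  apply le_antisymm
  · rw [veroneseModule, Submodule.span_le]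
    rintro _ ⟨j, rfl⟩
    simp only
    rw [X_pow_mul_X_pow_eq_monomial]
    refine monomial_mem_gradedPart ?_
    rw [degree_pairExp, Nat.sub_add_cancel (Nat.lt_succ_iff.mp j.2)]
  · intro f hf
    obtain ⟨g, hfg, hg⟩ := exists_eq_sum_monomial_mul_of_mem_gradedPart (i := 0) (j := i)
      (degreeExps i) hf (fun w hw => by rw [mem_degreeExps.mp hw]) (fun e he => by
        refine exists_le_of_le_degree ?_
        have := hf e he
        rw [Nat.ModEq, Nat.mod_eq_of_lt hi] at this
        rw [← this]
        exact Nat.mod_le _ _)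
    rw [hfg]
    refine Submodule.sum_mem _ fun w hw => ?_
    have hgw := mem_gradedPart_zero.mp (hg w hw)
    rw [mul_comm]
    refine Submodule.smul_mem _ (⟨g w, hgw⟩ : veronese k d) (Submodule.subset_span ?_)
    obtain ⟨j, hj, rfl⟩ := Finset.mem_image.mp hw
    exact ⟨⟨j, Finset.mem_range.mp hj⟩, X_pow_mul_X_pow_eq_monomial _ _⟩

end GradedPart

/-! ### The R-linear retraction of k[[x,y]] onto R, and Noetherianity. -/

section Reynolds

open MvPowerSeries

variable (k : Type u) [Field k] (d : ℕ)

/-- The part of degree divisible by `d` of a power series. -/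
def veronesePart (f : MvPowerSeries (Fin 2) k) : MvPowerSeries (Fin 2) k := fun e =>
  if d ∣ e.degree then coeff e f else 0

theorem coeff_veronesePart (f : MvPowerSeries (Fin 2) k) (e : Fin 2 →₀ ℕ) :
    coeff e (veronesePart k d f) = if d ∣ e.degree then coeff e f else 0 := rfl

/-- The projection of `k⟦x, y⟧` onto its Veronese subring. -/
def veroneseProj : MvPowerSeries (Fin 2) k →ₗ[veronese k d] veronese k d where
  toFun f := ⟨veronesePart k d f, fun e he => by rw [coeff_veronesePart, if_neg he]⟩
  map_add' f g := by
    refine Subtype.ext (MvPowerSeries.ext fun e => ?_)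
    simp only [Subalgebra.coe_add, map_add, coeff_veronesePart]
    split_ifs <;> simp
  map_smul' r f := by
    classical
    refine Subtype.ext (MvPowerSeries.ext fun e => ?_)
    simp only [RingHom.id_apply, smul_eq_mul, Subalgebra.coe_mul, Subalgebra.smul_def]
    rw [coeff_veronesePart, coeff_mul, coeff_mul]
    by_cases he : d ∣ e.degree
    · rw [if_pos he]
      refine Finset.sum_congr rfl fun p hp => ?_
      rw [Finset.HasAntidiagonal.mem_antidiagonal] at hp
      by_cases h1 : d ∣ p.1.degree
      · rw [coeff_veronesePart, if_pos]
        rw [← hp, map_add] at he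
        exact (Nat.dvd_add_right h1).mp he
      · rw [mem_veronese.mp r.2 _ h1, zero_mul, zero_mul]
    · rw [if_neg he, eq_comm]
      refine Finset.sum_eq_zero fun p hp => ?_
      rw [Finset.HasAntidiagonal.mem_antidiagonal] at hp
      by_cases h1 : d ∣ p.1.degree
      · rw [coeff_veronesePart, if_neg, mul_zero]
        intro h2
        rw [← hp, map_add] at he
        exact he (dvd_add h1 h2)
      · rw [mem_veronese.mp r.2 _ h1, zero_mul]

theorem veroneseProj_coe (r : veronese k d) : veroneseProj k d r = r := by
  refine Subtype.ext (MvPowerSeries.ext fun e => ?_)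
  change coeff e (veronesePart k d r) = _
  rw [coeff_veronesePart]
  split_ifs with h
  · rfl
  · exact (mem_veronese.mp r.2 e h).symm

theorem veroneseProj_mem_of_mem_map {I : Ideal (veronese k d)} {s : MvPowerSeries (Fin 2) k}
    (hs : s ∈ I.map (algebraMap (veronese k d) (MvPowerSeries (Fin 2) k))) :
    veroneseProj k d s ∈ I := by
  induction hs using Submodule.span_induction with
  | mem x hx =>
    obtain ⟨r, hr, rfl⟩ := hx
    exact (veroneseProj_coe k d r).symm ▸ hr
  | zero => simp
  | add x y _ _ hx hy =>
    rw [map_add]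
    exact add_mem hx hy
  | smul a x hx ih =>
    -- The projection is only R-linear, so the hypothesis for `x` says nothing about `a • x` with
    -- `a` in S; a second induction, with `a` generalized, replaces it.
    clear ih
    induction hx using Submodule.span_induction generalizing a with
    | mem x hx =>
      obtain ⟨r, hr, rfl⟩ := hx
      have : a • (algebraMap (veronese k d) (MvPowerSeries (Fin 2) k)) r = r • a := mul_comm _ _
      rw [this, map_smul]
      exact Ideal.mul_mem_right _ _ hr
    | zero => simp
    | add x y _ _ hx hy =>
      rw [smul_add, map_add]
      exact add_mem (hx a) (hy a)
    | smul b x _ ih =>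
      rw [smul_smul]
      exact ih (a * b)

/-- The retraction shows that extending an ideal to S and contracting it gives the ideal back, so
ascending chains in R embed into those of the Noetherian ring S. -/
instance veronese_isNoetherianRing : IsNoetherianRing (veronese k d) := by
  rw [isNoetherianRing_iff, isNoetherian_iff']
  have hmono : StrictMono fun I : Ideal (veronese k d) =>
      I.map (algebraMap (veronese k d) (MvPowerSeries (Fin 2) k)) := by
    refine Monotone.strictMono_of_injective (fun I J h => Ideal.map_mono h) ?_
    refine Function.LeftInverse.injective (g := Ideal.comap (algebraMap (veronese k d) _))
      fun I => le_antisymm (fun r hr => ?_) Ideal.le_comap_map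
    rw [← veroneseProj_coe k d r]
    exact veroneseProj_mem_of_mem_map k d hr
  exact hmono.wellFoundedGT

variable {k d}

theorem mem_maximalIdeal_veronese {f : veronese k d} :
    f ∈ IsLocalRing.maximalIdeal (veronese k d) ↔
      constantCoeff (f : MvPowerSeries (Fin 2) k) = 0 := by
  rw [IsLocalRing.mem_maximalIdeal, mem_nonunits_iff, not_iff_comm, ← ne_eq, ← isUnit_iff_ne_zero,
    ← MvPowerSeries.isUnit_iff_constantCoeff]
  constructor
  · intro h
    obtain ⟨g, hg⟩ := h.exists_right_inv
    have h1 : veroneseProj k d (f • g) = 1 := by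
      rw [Subalgebra.smul_def, smul_eq_mul, hg]
      exact veroneseProj_coe k d 1
    rw [map_smul, smul_eq_mul] at h1
    exact IsUnit.of_mul_eq_one _ h1
  · intro h
    exact h.map (veronese k d).val

end Reynolds

end

noncomputable section

/-! ### Powers of the maximal ideal as order conditions, and completeness. -/

section MaximalIdealPowers

open MvPowerSeries IsLocalRing

variable {k : Type u} [Field k] {d : ℕ}

/-- A monomial of degree divisible by `d` as an element of the Veronese subring. -/
def veroneseMonomial (w : Fin 2 →₀ ℕ) (h : d ∣ w.degree) : veronese k d :=
  ⟨monomial w 1, monomial_mem_veronese h⟩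

theorem mem_ideal_of_monomials (I : Ideal (veronese k d)) (T : Finset (Fin 2 →₀ ℕ))
    (hT : ∀ w ∈ T, ∃ h : d ∣ w.degree, (veroneseMonomial w h : veronese k d) ∈ I)
    (f : veronese k d)
    (h : ∀ e, coeff e (f : MvPowerSeries (Fin 2) k) ≠ 0 → ∃ w ∈ T, w ≤ e) : f ∈ I := by
  obtain ⟨g, hfg, -⟩ := exists_eq_sum_monomial_mul T (f : MvPowerSeries (Fin 2) k) h
  rw [← veroneseProj_coe k d f, hfg, map_sum]
  refine sum_mem fun w hw => ?_
  obtain ⟨hwd, hwI⟩ := hT w hw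
  have : monomial w 1 * g w = (veroneseMonomial w hwd : veronese k d) • g w := rfl
  rw [this, map_smul]
  exact Ideal.mul_mem_right _ _ hwI

theorem veroneseMonomial_mem_maximalIdeal {w : Fin 2 →₀ ℕ} (h : d ∣ w.degree) (hw : w ≠ 0) :
    (veroneseMonomial w h : veronese k d) ∈ maximalIdeal (veronese k d) := by
  classical
  rw [mem_maximalIdeal_veronese, ← coeff_zero_eq_constantCoeff_apply]
  exact (coeff_monomial _ _ _).trans (if_neg hw.symm)

theorem veroneseMonomial_mem_maximalIdeal_pow (hd : d ≠ 0) (n : ℕ) {w : Fin 2 →₀ ℕ}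
    (h : d ∣ w.degree) (hw : w.degree = d * n) :
    (veroneseMonomial w h : veronese k d) ∈ maximalIdeal (veronese k d) ^ n := by
  induction n generalizing w with
  | zero => simp
  | succ n ih =>
    obtain ⟨v, hv, hvw⟩ := exists_le_of_le_degree (n := d) (e := w) (by rw [hw]; nlinarith)
    obtain ⟨u, rfl⟩ := exists_add_of_le hvw
    rw [mem_degreeExps] at hv
    have hu : u.degree = d * n := by
      rw [map_add, hv] at hw
      linarith
    have hmul : (veroneseMonomial (v + u) h : veronese k d) =
        veroneseMonomial u ⟨n, hu⟩ * veroneseMonomial v ⟨1, by rw [hv, mul_one]⟩ := by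
      refine Subtype.ext ?_
      change monomial (v + u) 1 = monomial u 1 * monomial v 1
      rw [monomial_mul_monomial, one_mul, add_comm]
    rw [hmul, pow_succ]
    refine Ideal.mul_mem_mul (ih _ hu) (veroneseMonomial_mem_maximalIdeal _ ?_)
    rintro rfl
    exact hd (by rw [← hv, map_zero])

theorem mem_maximalIdeal_pow_iff (hd : d ≠ 0) (n : ℕ) (f : veronese k d) :
    f ∈ maximalIdeal (veronese k d) ^ n ↔
      ∀ e, coeff e (f : MvPowerSeries (Fin 2) k) ≠ 0 → d * n ≤ e.degree := by
  constructor
  · induction n generalizing f with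
    | zero => simp
    | succ n ih =>
      intro hf
      rw [pow_succ] at hf
      induction hf using Submodule.mul_induction_on' with
      | mem_mul_mem p hp q hq =>
        intro e he
        obtain ⟨u, v, rfl, hu, hv⟩ := exists_of_coeff_mul_ne_zero he
        have h1 := ih p hp u hu
        have h2 : d ≤ v.degree := by
          refine Nat.le_of_dvd (Nat.pos_of_ne_zero fun h0 => hv ?_) (mem_veronese_iff.mp q.2 v hv)
          rw [Finsupp.degree_eq_zero_iff] at h0
          rw [h0, coeff_zero_eq_constantCoeff_apply]
          exact mem_maximalIdeal_veronese.mp hq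
        rw [map_add, mul_add_one]
        exact add_le_add h1 h2
      | add p _ q _ hp hq =>
        intro e he
        by_cases h : coeff e (p : MvPowerSeries (Fin 2) k) = 0
        · refine hq e fun h' => he ?_
          rw [Subalgebra.coe_add, map_add, h, h', add_zero]
        · exact hp e h
  · intro h
    refine mem_ideal_of_monomials _ (degreeExps (d * n)) (fun w hw => ?_) f
      fun e he => exists_le_of_le_degree (h e he)
    rw [mem_degreeExps] at hw
    exact ⟨⟨n, hw⟩, veroneseMonomial_mem_maximalIdeal_pow hd n _ hw⟩

theorem veronese_isAdicComplete (hd : d ≠ 0) :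
    IsAdicComplete (maximalIdeal (veronese k d)) (veronese k d) := by
  have hd1 : 1 ≤ d := Nat.one_le_iff_ne_zero.mpr hd
  refine { haus' := fun x hx => ?_, prec' := fun f hf => ?_ }
  · refine Subtype.ext (MvPowerSeries.ext fun e => ?_)
    by_contra he
    have h1 := hx (e.degree + 1)
    rw [SModEq.zero, smul_eq_mul, Ideal.mul_top, mem_maximalIdeal_pow_iff hd] at h1
    have h2 := h1 e he
    nlinarith
  · have hcoeff : ∀ m n e, m ≤ n → e.degree < d * m →
        coeff e (f m : MvPowerSeries (Fin 2) k) = coeff e (f n : MvPowerSeries (Fin 2) k) := by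
      intro m n e hmn he
      have h1 := (SModEq.sub_mem.mp (hf hmn))
      rw [smul_eq_mul, Ideal.mul_top, mem_maximalIdeal_pow_iff hd] at h1
      by_contra hne
      refine absurd (h1 e ?_) (not_le.mpr he)
      rw [Subalgebra.coe_sub, map_sub]
      exact sub_ne_zero.mpr hne
    -- The sequence is constant in the coefficient at e from index `e.degree + 1` on, since
    -- `e.degree < d * (e.degree + 1)`.
    let g : MvPowerSeries (Fin 2) k := fun e =>
      coeff e (f (e.degree + 1) : MvPowerSeries (Fin 2) k)
    have hg : ∀ e, coeff e g = coeff e (f (e.degree + 1) : MvPowerSeries (Fin 2) k) :=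
      fun _ => rfl
    refine ⟨⟨g, fun e he => ?_⟩, fun n => ?_⟩
    · rw [hg]
      exact (f (e.degree + 1)).2 e he
    · rw [SModEq.sub_mem, smul_eq_mul, Ideal.mul_top, mem_maximalIdeal_pow_iff hd]
      intro e he
      by_contra! hlt
      refine he ?_
      rw [Subalgebra.coe_sub, map_sub, sub_eq_zero]
      change _ = coeff e g
      rw [hg]
      rcases le_total n (e.degree + 1) with h | h
      · exact hcoeff _ _ e h hlt
      · exact (hcoeff _ _ e h (by nlinarith)).symm

end MaximalIdealPowers

/-! ### The system of parameters x^d, y^d. -/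

section Parameters

open MvPowerSeries IsLocalRing

variable (k : Type u) [Field k] (d : ℕ)

/-- The element `x ^ d` of the Veronese subring. -/
def veroneseX : veronese k d := veroneseMonomial (pairExp d 0) (by simp)

/-- The element `y ^ d` of the Veronese subring. -/
def veroneseY : veronese k d := veroneseMonomial (pairExp 0 d) (by simp)

variable {k d}

theorem veroneseX_pow (t : ℕ) : veroneseX k d ^ t =
    veroneseMonomial (pairExp (d * t) 0) (by simp) := by
  refine Subtype.ext ?_
  change (monomial (pairExp d 0) 1 : MvPowerSeries (Fin 2) k) ^ t = monomial _ 1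
  rw [← X_pow_mul_X_pow_eq_monomial, ← X_pow_mul_X_pow_eq_monomial, pow_zero, mul_one, mul_one,
    ← pow_mul]

theorem veroneseY_pow (t : ℕ) : veroneseY k d ^ t =
    veroneseMonomial (pairExp 0 (d * t)) (by simp) := by
  refine Subtype.ext ?_
  change (monomial (pairExp 0 d) 1 : MvPowerSeries (Fin 2) k) ^ t = monomial _ 1
  rw [← X_pow_mul_X_pow_eq_monomial, ← X_pow_mul_X_pow_eq_monomial, pow_zero, one_mul, one_mul,
    ← pow_mul]

theorem le_of_coeff_monomial_mul_ne_zero {w e : Fin 2 →₀ ℕ} {f : MvPowerSeries (Fin 2) k}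
    (h : coeff e (monomial w 1 * f) ≠ 0) : w ≤ e := by
  classical
  rw [coeff_monomial_mul] at h
  by_contra hw
  exact h (if_neg hw)

theorem mem_span_veroneseX_veroneseY_pow {t : ℕ} {f : veronese k d} :
    f ∈ Ideal.span {veroneseX k d ^ t, veroneseY k d ^ t} ↔
      ∀ e, coeff e (f : MvPowerSeries (Fin 2) k) ≠ 0 → d * t ≤ e 0 ∨ d * t ≤ e 1 := by
  classical
  constructor
  · intro hf e he
    obtain ⟨p, q, rfl⟩ := Ideal.mem_span_pair.mp hf
    rw [veroneseX_pow, veroneseY_pow] at he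
    change coeff e ((p : MvPowerSeries (Fin 2) k) * monomial (pairExp (d * t) 0) 1 +
      (q : MvPowerSeries (Fin 2) k) * monomial (pairExp 0 (d * t)) 1) ≠ 0 at he
    rw [map_add, mul_comm, mul_comm (q : MvPowerSeries (Fin 2) k)] at he
    by_cases h : coeff e (monomial (pairExp (d * t) 0) 1 * (p : MvPowerSeries (Fin 2) k)) = 0
    · rw [h, zero_add] at he
      right
      simpa using (Finsupp.le_fin_two.mp (le_of_coeff_monomial_mul_ne_zero he)).2
    · left
      simpa using (Finsupp.le_fin_two.mp (le_of_coeff_monomial_mul_ne_zero h)).1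
  · intro h
    refine mem_ideal_of_monomials _ {pairExp (d * t) 0, pairExp 0 (d * t)} ?_ f fun e he => ?_
    · intro w hw
      rw [Finset.mem_insert, Finset.mem_singleton] at hw
      rcases hw with rfl | rfl
      · exact ⟨by simp, by
          rw [← veroneseX_pow]
          exact Ideal.subset_span (Set.mem_insert _ _)⟩
      · exact ⟨by simp, by
          rw [← veroneseY_pow]
          exact Ideal.subset_span (Set.mem_insert_of_mem _ rfl)⟩
    · rcases h e he with h | h
      · exact ⟨_, Finset.mem_insert_self _ _, by rw [Finsupp.le_fin_two]; simpa using h⟩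
      · exact ⟨_, Finset.mem_insert_of_mem (Finset.mem_singleton_self _), by
          rw [Finsupp.le_fin_two]; simpa using h⟩

theorem veroneseX_mem_maximalIdeal (hd : d ≠ 0) : veroneseX k d ∈ maximalIdeal (veronese k d) :=
  veroneseMonomial_mem_maximalIdeal _ fun h => hd (by
    rw [← pairExp_zero d 0, h, Finsupp.zero_apply])

theorem veroneseY_mem_maximalIdeal (hd : d ≠ 0) : veroneseY k d ∈ maximalIdeal (veronese k d) :=
  veroneseMonomial_mem_maximalIdeal _ fun h => hd (by
    rw [← pairExp_one 0 d, h, Finsupp.zero_apply])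

theorem maximalIdeal_le_radical_span_pow (hd : d ≠ 0) (t : ℕ) :
    maximalIdeal (veronese k d) ≤
      (Ideal.span {veroneseX k d ^ t, veroneseY k d ^ t}).radical := by
  intro f hf
  -- Monomials of an element of the (2t)-th power of the maximal ideal have degree at least 2 d t,
  -- so one of the two exponents is at least d t.
  refine ⟨2 * t, ?_⟩
  rw [mem_span_veroneseX_veroneseY_pow]
  intro e he
  have h := (mem_maximalIdeal_pow_iff hd (2 * t) _).mp (Ideal.pow_mem_pow hf _) e he
  rw [Finsupp.degree_fin_two] at h
  by_contra! hlt
  nlinarith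

/-- Multiplying by a power of y does not change x-exponents, so x^(dt) already divides every
monomial of `f`. The quotient stays in class i because d divides dt. This is regularity of y^(dt)
modulo x^(dt). -/
theorem gradedPart_smul_eq_smul {i t : ℕ} {f g : MvPowerSeries (Fin 2) k}
    (hf : f ∈ gradedPart k d i)
    (h : veroneseY k d ^ t • f = veroneseX k d ^ t • g) :
    ∃ q ∈ gradedPart k d i, f = veroneseX k d ^ t • q := by
  rw [veroneseY_pow, veroneseX_pow] at h
  change monomial (pairExp 0 (d * t)) 1 * f = monomial (pairExp (d * t) 0) 1 * g at h
  obtain ⟨q, hq, hqi⟩ := exists_eq_sum_monomial_mul_of_mem_gradedPart (i := i) (j := 0)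
    {pairExp (d * t) 0} (by rwa [zero_add])
    (fun w hw => by
      rw [Finset.mem_singleton.mp hw, degree_pairExp, Nat.modEq_zero_iff_dvd]
      simp)
    (fun e he => by
      refine ⟨_, Finset.mem_singleton_self _, ?_⟩
      have h1 : coeff (pairExp 0 (d * t) + e) (monomial (pairExp 0 (d * t)) 1 * f) ≠ 0 := by
        rw [coeff_add_monomial_mul, one_mul]
        exact he
      rw [h] at h1
      have h2 := (Finsupp.le_fin_two.mp (le_of_coeff_monomial_mul_ne_zero h1)).1
      rw [Finsupp.le_fin_two]
      simpa using h2)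
  rw [Finset.sum_singleton] at hq
  refine ⟨_, hqi _ (Finset.mem_singleton_self _), hq.trans ?_⟩
  rw [veroneseX_pow]
  rfl

theorem veroneseMonomial_smul_eq_zero {w : Fin 2 →₀ ℕ} (h : d ∣ w.degree)
    {f : MvPowerSeries (Fin 2) k} (hf : (veroneseMonomial w h : veronese k d) • f = 0) :
    f = 0 := by
  ext e
  have h1 : coeff (w + e) (monomial w 1 * f) = 0 := congrArg (coeff (w + e)) hf
  rwa [coeff_add_monomial_mul, one_mul] at h1

theorem veronese_isKoszulRegular (t : ℕ) :
    IsKoszulRegular (veroneseX k d ^ t) (veroneseY k d ^ t) where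
  left r hr := by
    rw [veroneseX_pow] at hr
    exact Subtype.ext (veroneseMonomial_smul_eq_zero (f := (r : MvPowerSeries (Fin 2) k)) _
      (congrArg Subtype.val hr))
  right r s h := by
    obtain ⟨q, hq, hr⟩ := gradedPart_smul_eq_smul (mem_gradedPart_zero.mpr r.2)
      (g := (s : MvPowerSeries (Fin 2) k)) (congrArg Subtype.val h)
    exact ⟨⟨q, mem_gradedPart_zero.mp hq⟩, Subtype.ext hr⟩

end Parameters

end

noncomputable section

/-! ### Krull dimension and the maximal Cohen–Macaulay property. -/

section CohenMacaulay

open MvPowerSeries IsLocalRing RingTheory.Sequence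

variable {k : Type u} [Field k] {d : ℕ}

instance gradedPart_nontrivial (i : ℕ) : Nontrivial (gradedPart k d i) := by
  classical
  refine ⟨⟨⟨monomial (pairExp i 0) 1, monomial_mem_gradedPart (by simp [Nat.ModEq.refl])⟩, 0,
    fun h => ?_⟩⟩
  have h1 : coeff (pairExp i 0) (monomial (pairExp i 0) (1 : k)) = 0 :=
    (congrArg (fun f => coeff (pairExp i 0) (Subtype.val f)) h).trans (map_zero _)
  rw [coeff_monomial_same] at h1
  exact one_ne_zero h1

theorem gradedPart_finite {i : ℕ} (hi : i < d) :
    Module.Finite (veronese k d) (gradedPart k d i) := by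
  rw [← veroneseModule_eq_gradedPart hi, Module.Finite.iff_fg]
  exact Submodule.fg_span (Set.finite_range _)

theorem mem_maximalIdeal_of_mem_pair (hd : d ≠ 0) (r : veronese k d)
    (hr : r ∈ [veroneseX k d, veroneseY k d]) : r ∈ maximalIdeal (veronese k d) := by
  rw [List.mem_pair] at hr
  rcases hr with rfl | rfl
  · exact veroneseX_mem_maximalIdeal hd
  · exact veroneseY_mem_maximalIdeal hd

theorem gradedPart_isRegular {i : ℕ} (hi : i < d) :
    IsRegular (gradedPart k d i) [veroneseX k d, veroneseY k d] := by
  have := gradedPart_finite (k := k) hi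
  refine IsRegular.of_isWeaklyRegular_of_mem_maximalIdeal _
    (mem_maximalIdeal_of_mem_pair (by omega)) ((isWeaklyRegular_cons_iff _ _ _).mpr
      ⟨?_, (isWeaklyRegular_singleton_iff _ _).mpr ?_⟩)
  · refine (isSMulRegular_iff_right_eq_zero_of_smul).mpr fun f hf => ?_
    exact Subtype.ext (veroneseMonomial_smul_eq_zero _ (congrArg Subtype.val hf))
  · refine (isSMulRegular_quotient_iff_mem_of_smul_mem _ _).mpr fun f hf => ?_
    obtain ⟨g, -, hg⟩ := (Submodule.mem_smul_pointwise_iff_exists _ _ _).mp hf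
    obtain ⟨q, hq, hfq⟩ := gradedPart_smul_eq_smul (t := 1) f.2
      (g := (g : MvPowerSeries (Fin 2) k)) (by
        rw [pow_one, pow_one]
        exact congrArg Subtype.val hg.symm)
    rw [pow_one] at hfq
    exact (Submodule.mem_smul_pointwise_iff_exists _ _ _).mpr
      ⟨⟨q, hq⟩, trivial, Subtype.ext hfq.symm⟩

variable (k d) in
/-- The Veronese subring as the part of degree divisible by `d`. -/
def veroneseEquivGradedPart : veronese k d ≃ₗ[veronese k d] gradedPart k d 0 where
  toFun r := ⟨r, mem_gradedPart_zero.mpr r.2⟩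
  map_add' _ _ := rfl
  map_smul' _ _ := rfl
  invFun f := ⟨f, mem_gradedPart_zero.mp f.2⟩
  left_inv _ := rfl
  right_inv _ := rfl

theorem veronese_isRegular (hd : d ≠ 0) :
    IsRegular (veronese k d) [veroneseX k d, veroneseY k d] :=
  (LinearEquiv.isRegular_congr (veroneseEquivGradedPart k d) _).mpr
    (gradedPart_isRegular (Nat.pos_of_ne_zero hd))

/-- A regular sequence of length 2 lowers the dimension by 2, and the quotient has dimension 0
because every prime containing x^d and y^d is the maximal ideal. -/
theorem ringKrullDim_veronese (hd : d ≠ 0) : ringKrullDim (veronese k d) = 2 := by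
  let I : Ideal (veronese k d) := Ideal.ofList [veroneseX k d, veroneseY k d]
  have hI : I = Ideal.span {veroneseX k d ^ 1, veroneseY k d ^ 1} := by
    rw [pow_one, pow_one]
    simp [I, Ideal.ofList_cons, Ideal.span_insert]
  have hle : maximalIdeal (veronese k d) ≤ I.radical :=
    hI ▸ maximalIdeal_le_radical_span_pow hd 1
  have hIm : I ≤ maximalIdeal (veronese k d) :=
    Ideal.span_le.mpr (mem_maximalIdeal_of_mem_pair hd)
  have : Nontrivial (veronese k d ⧸ I) :=
    Ideal.Quotient.nontrivial_iff.mpr (ne_top_of_le_ne_top (Ideal.IsPrime.ne_top' ) hIm)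
  have : Ring.KrullDimLE 0 (veronese k d ⧸ I) := by
    rw [Ring.krullDimLE_zero_iff]
    intro P hP
    have h1 : maximalIdeal (veronese k d) ≤ P.comap (Ideal.Quotient.mk I) := by
      refine hle.trans ((Ideal.IsPrime.radical_le_iff inferInstance).mpr ?_)
      exact fun x hx => by
        rw [Ideal.mem_comap, Ideal.Quotient.eq_zero_iff_mem.mpr hx]
        exact P.zero_mem
    have h2 : (P.comap (Ideal.Quotient.mk I)).IsMaximal := by
      rw [← (maximalIdeal.isMaximal (veronese k d)).eq_of_le (Ideal.IsPrime.ne_top inferInstance)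
        h1]
      infer_instance
    rw [← Ideal.map_comap_of_surjective _ Ideal.Quotient.mk_surjective P]
    refine (Ideal.map_eq_top_or_isMaximal_of_surjective _ Ideal.Quotient.mk_surjective
      h2).resolve_left ?_
    rw [Ideal.map_comap_of_surjective _ Ideal.Quotient.mk_surjective P]
    exact hP.ne_top
  have h0 : ringKrullDim (veronese k d ⧸ I) = 0 :=
    ringKrullDimZero_iff_ringKrullDim_eq_zero.mp inferInstance
  have := ringKrullDim_add_length_eq_ringKrullDim_of_isRegular _ (veronese_isRegular (k := k) hd)
  rw [← this]
  change ringKrullDim (veronese k d ⧸ I) + _ = _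
  rw [h0]
  rfl

theorem isMaximalCohenMacaulay_veronese (hd : d ≠ 0) :
    IsMaximalCohenMacaulay (veronese k d) (veronese k d) :=
  ⟨inferInstance, _, mem_maximalIdeal_of_mem_pair hd, veronese_isRegular hd,
    ringKrullDim_veronese hd⟩

theorem isMaximalCohenMacaulay_veroneseModule {i : ℕ} (hi : i < d) :
    IsMaximalCohenMacaulay (veronese k d) (veroneseModule k d i) := by
  have hd : d ≠ 0 := by omega
  rw [veroneseModule_eq_gradedPart hi]
  exact ⟨gradedPart_finite hi, _, mem_maximalIdeal_of_mem_pair hd, gradedPart_isRegular hi,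
    ringKrullDim_veronese hd⟩

end CohenMacaulay

/-! ### Matlis duality detects nonzero elements; rationality as closedness of zero. -/

section Cogenerator

variable {R : Type u} [CommRing R]

/-- The injective hull of the residue field is a cogenerator. -/
theorem exists_matlisDual_apply_ne_zero [IsLocalRing R] {M : Type u} [AddCommGroup M]
    [Module R M] {x : M}
    (hx : x ≠ 0) : ∃ f : MatlisDual R M, f x ≠ 0 := by
  have hE := injectiveHullEmbedding_isInjectiveHull R (IsLocalRing.ResidueField R)
  -- The cyclic module Rx is R/A with A the annihilator of x, a proper ideal; it maps onto the
  -- residue field inside E, and injectivity of E extends this map to M.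
  let A := LinearMap.ker (LinearMap.toSpanSingleton R M x)
  have hA : A ≤ IsLocalRing.maximalIdeal R := by
    refine IsLocalRing.le_maximalIdeal fun h => hx ?_
    have h1 : (1 : R) ∈ A := h ▸ Submodule.mem_top
    simpa [A] using h1
  let ι : (R ⧸ A) →ₗ[R] M := A.liftQ (LinearMap.toSpanSingleton R M x) le_rfl
  have hι : Function.Injective ι := by
    rw [← LinearMap.ker_eq_bot]
    exact Submodule.ker_liftQ_eq_bot _ _ _ le_rfl
  let p : (R ⧸ A) →ₗ[R] IsLocalRing.ResidueField R :=
    A.liftQ (Algebra.linearMap R (IsLocalRing.ResidueField R)) fun r hr => by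
      rw [LinearMap.mem_ker, Algebra.linearMap_apply]
      exact (IsLocalRing.residue_eq_zero_iff r).mpr (hA hr)
  obtain ⟨f, hf⟩ := hE.injective_module.out ι hι
    (injectiveHullEmbedding R (IsLocalRing.ResidueField R) ∘ₗ p)
  refine ⟨f, fun h0 => ?_⟩
  have h1 : ι (Submodule.Quotient.mk 1) = x :=
    (Submodule.liftQ_apply A _ 1).trans (one_smul R x)
  have h2 := hf (Submodule.Quotient.mk 1)
  rw [h1, h0, eq_comm, LinearMap.comp_apply] at h2
  have h3 := hE.injective (h2.trans (map_zero _).symm)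
  have h4 : p (Submodule.Quotient.mk 1) = 1 :=
    (Submodule.liftQ_apply A _ 1).trans (map_one (algebraMap R _))
  exact one_ne_zero (h4.symm.trans h3)

/-- A ring is rational for a closure operation if and only if the zero submodule of its top local
cohomology is closed. -/
theorem isClRational_iff [IsLocalRing R] (c : ModClosure R) :
    IsClRational R c ↔ c.cl (topLocalCohomology R) ⊥ = ⊥ := by
  rw [IsClRational, eq_top_iff, eq_bot_iff]
  constructor
  · intro h x hx
    by_contra hne
    obtain ⟨f, hf⟩ := exists_matlisDual_apply_ne_zero (R := R) (M := topLocalCohomology R) hne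
    exact hf (h (Submodule.mem_top (x := f)) x hx)
  · intro h f _ x hx
    rw [(Submodule.mem_bot R).mp (h hx), map_zero]

theorem mem_moduleClosure_bot {B : Type u} [AddCommGroup B] [Module R B] {M : Type u}
    [AddCommGroup M] [Module R M] {x : M} :
    x ∈ (moduleClosure R B).cl M ⊥ ↔ ∀ b : B, b ⊗ₜ[R] x = 0 := by
  have h0 : LinearMap.lTensor B (⊥ : Submodule R M).subtype = 0 := by
    rw [show (⊥ : Submodule R M).subtype = 0 from LinearMap.ext fun y => by
      simp [(Submodule.mem_bot R).mp y.2], LinearMap.lTensor_zero]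
  refine forall_congr' fun b => ?_
  rw [h0, LinearMap.range_zero, Submodule.mem_bot]

end Cogenerator

end

noncomputable section

/-! ### Additive maps out of a directed union of classes. -/

section DirectedClasses

variable {R : Type*} [CommRing R] {H : Type*} [AddCommGroup H] [Module R H]

/-- Additive maps out of a directed union of images of `R` along multiplication by `c`. -/
theorem exists_addMonoidHom_of_classes (c : R) (π : ℕ → R →ₗ[R] H)
    (hsurj : ∀ z, ∃ t r, π t r = z) (hπ : ∀ t r, π (t + 1) (c * r) = π t r)
    {A : Type*} [AddCommGroup A] (l : ℕ → R →+ A) (hl : ∀ t r, l (t + 1) (c * r) = l t r)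
    (h0 : ∀ t r, π t r = 0 → l t r = 0) :
    ∃ L : H →+ A, ∀ t r, L (π t r) = l t r := by
  have hπs : ∀ s t r, π (t + s) (c ^ s * r) = π t r := by
    intro s
    induction s with
    | zero => simp
    | succ s ih =>
      intro t r
      rw [← add_assoc, pow_succ', mul_assoc, hπ, ih]
  have hls : ∀ s t r, l (t + s) (c ^ s * r) = l t r := by
    intro s
    induction s with
    | zero => simp
    | succ s ih =>
      intro t r
      rw [← add_assoc, pow_succ', mul_assoc, hl, ih]
  -- Both representatives are moved to the common level t + t', where their difference has class
  -- zero.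
  have key : ∀ t r t' r', π t r = π t' r' → l t r = l t' r' := by
    intro t r t' r' h
    rw [← hπs t' t r, ← hπs t t' r', add_comm t' t, ← sub_eq_zero, ← map_sub] at h
    have := h0 _ _ h
    rwa [map_sub, sub_eq_zero, hls, add_comm t t', hls] at this
  choose τ ρ hτ using hsurj
  have hL : ∀ t r, l (τ (π t r)) (ρ (π t r)) = l t r := fun t r => key _ _ _ _ (hτ _)
  refine ⟨AddMonoidHom.mk' (fun z => l (τ z) (ρ z)) fun y z => ?_, hL⟩
  have h1 : π (τ y + τ z) (c ^ τ z * ρ y + c ^ τ y * ρ z) = y + z := by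
    rw [map_add, hπs, add_comm (τ y), hπs, hτ, hτ]
  rw [key _ _ _ _ ((hτ (y + z)).trans h1.symm), map_add, hls, add_comm (τ y), hls]

end DirectedClasses

/-! ### The residue pairing between top local cohomology and k[[x,y]]. -/

section Residue

open MvPowerSeries IsLocalRing

variable {k : Type u} [Field k] {d : ℕ}

theorem topLocalCohomology_veronese (hd : d ≠ 0) : topLocalCohomology (veronese k d) =
    (localCohomology (maximalIdeal (veronese k d)) 2).obj
      (ModuleCat.of (veronese k d) (veronese k d)) := by
  rw [topLocalCohomology, ringKrullDim_veronese hd]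
  rfl

variable (k d) in
/-- The coefficient of `(x y) ^ (d (t + 1) - 1)` in a product. -/
def residueForm (t : ℕ) : veronese k d →+ MvPowerSeries (Fin 2) k →+ k :=
  (AddMonoidHom.compHom
    (coeff (R := k) (pairExp (d * (t + 1) - 1) (d * (t + 1) - 1))).toAddMonoidHom).comp
    (AddMonoidHom.mul.comp (veronese k d).val.toRingHom.toAddMonoidHom)

theorem residueForm_apply (t : ℕ) (r : veronese k d) (s : MvPowerSeries (Fin 2) k) :
    residueForm k d t r s = coeff (pairExp (d * (t + 1) - 1) (d * (t + 1) - 1))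
      ((r : MvPowerSeries (Fin 2) k) * s) := rfl

theorem residueForm_mul_left (t : ℕ) (r r' : veronese k d) (s : MvPowerSeries (Fin 2) k) :
    residueForm k d t (r' * r) s = residueForm k d t r (r' • s) := by
  rw [residueForm_apply, residueForm_apply, Subalgebra.coe_mul, Subalgebra.smul_def, smul_eq_mul,
    mul_left_comm, mul_assoc]

theorem residueForm_succ (hd : d ≠ 0) (t : ℕ) (r : veronese k d) :
    residueForm k d (t + 1) (veroneseX k d * veroneseY k d * r) = residueForm k d t r := by
  ext s
  have h1 : (veroneseX k d * veroneseY k d : veronese k d) =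
      (monomial (pairExp d d) 1 : MvPowerSeries (Fin 2) k) := by
    change (monomial _ 1 * monomial _ 1 : MvPowerSeries (Fin 2) k) = _
    rw [monomial_mul_monomial, one_mul, pairExp_add, add_zero, zero_add]
  have h2 : d * (t + 1 + 1) - 1 = d + (d * (t + 1) - 1) := by
    have : 1 ≤ d * (t + 1) := Nat.one_le_iff_ne_zero.mpr (by positivity)
    rw [mul_add_one d (t + 1)]
    omega
  rw [residueForm_apply, residueForm_apply, Subalgebra.coe_mul, h1, h2, ← pairExp_add, mul_assoc,
    coeff_add_monomial_mul, one_mul]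

/-- The exponent d(t+1) - 1 is the largest one below d(t+1), so no monomial divisible by x^(d(t+1))
or y^(d(t+1)) can divide the monomial whose coefficient is taken. -/
theorem residueForm_eq_zero (hd : d ≠ 0) {t : ℕ} {r : veronese k d}
    (hr : r ∈ Ideal.span {veroneseX k d ^ (t + 1), veroneseY k d ^ (t + 1)}) :
    residueForm k d t r = 0 := by
  ext s
  have h1 : 1 ≤ d * (t + 1) := Nat.one_le_iff_ne_zero.mpr (by positivity)
  by_contra hne
  obtain ⟨p, q, hpq, hp, -⟩ := exists_of_coeff_mul_ne_zero hne
  have h2 := mem_span_veroneseX_veroneseY_pow.mp hr p hp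
  have h3 : p ≤ pairExp (d * (t + 1) - 1) (d * (t + 1) - 1) := hpq ▸ le_self_add
  rw [Finsupp.le_fin_two, pairExp_zero, pairExp_one] at h3
  omega

/-- The classes of elements of `R` in the top local cohomology, together with the residue
pairing. -/
theorem exists_classes_residuePairing (hd : d ≠ 0) :
    ∃ (π : ℕ → veronese k d →ₗ[veronese k d] topLocalCohomology (veronese k d))
      (L : topLocalCohomology (veronese k d) →+ MvPowerSeries (Fin 2) k →+ k),
      (∀ z, ∃ t r, π t r = z) ∧
      (∀ t, ∀ r ∈ Ideal.span {veroneseX k d ^ (t + 1), veroneseY k d ^ (t + 1)}, π t r = 0) ∧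
      (∀ t r, L (π t r) = residueForm k d t r) := by
  rw [topLocalCohomology_veronese hd]
  obtain ⟨π, hsurj, hπ, hker, hzero⟩ := exists_localCohomology_two_classes (veroneseX k d)
    (veroneseY k d) (maximalIdeal (veronese k d))
    (fun t => maximalIdeal_le_radical_span_pow hd (t + 1)) (veroneseX_mem_maximalIdeal hd)
    (veroneseY_mem_maximalIdeal hd) (fun t => veronese_isKoszulRegular (t + 1))
  have hpow : ∀ s t (r : veronese k d),
      residueForm k d (t + s) ((veroneseX k d * veroneseY k d) ^ s * r) =
        residueForm k d t r := by
    intro s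
    induction s with
    | zero => simp
    | succ s ih =>
      intro t r
      rw [← add_assoc, pow_succ', mul_assoc, residueForm_succ hd, ih]
  obtain ⟨L, hL⟩ := exists_addMonoidHom_of_classes (veroneseX k d * veroneseY k d) π hsurj hπ
    (residueForm k d) (residueForm_succ hd) fun t r h => by
      obtain ⟨s, hs⟩ := hker t r h
      rw [← hpow s t r, residueForm_eq_zero hd hs]
  exact ⟨π, L, hsurj, hzero, hL⟩

end Residue

/-! ### The closure of zero for M_i, on both sides of the bound i ≤ d - 2. -/

section Rationality

open MvPowerSeries IsLocalRing

variable {k : Type u} [Field k] {d : ℕ}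

/-- Balancedness over R makes m ⊗ h ↦ `L h (g * m)` well defined on the tensor product. The factor
`g` ranges over all of S, which supplies the part of the complementary monomial outside M_i. -/
theorem pairing_eq_zero_of_tmul_eq_zero {H : Type u} [AddCommGroup H] [Module (veronese k d) H]
    (L : H →+ MvPowerSeries (Fin 2) k →+ k)
    (hL : ∀ (r : veronese k d) h s, L (r • h) s = L h (r • s))
    (M : Submodule (veronese k d) (MvPowerSeries (Fin 2) k)) (g : MvPowerSeries (Fin 2) k) (h : H)
    (b : M) (hb : b ⊗ₜ[veronese k d] h = 0) : L h (g * b) = 0 := by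
  let f : M →+ H →+ k :=
    (L.flip.comp (AddMonoidHom.mulLeft g)).comp M.subtype.toAddMonoidHom
  let F : M ⊗[veronese k d] H →+ k := TensorProduct.liftAddHom f fun r m h => by
    change L h (g * r • (m : MvPowerSeries (Fin 2) k)) = L (r • h) (g * m)
    rw [hL, mul_smul_comm]
  have hF : F (b ⊗ₜ[veronese k d] h) = L h (g * b) := TensorProduct.liftAddHom_tmul _ _ _ _
  rw [← hF, hb, map_zero]

theorem isClRational_veroneseModule (hd : 2 ≤ d) {i : ℕ} (hi : i ≤ d - 2) :
    IsClRational (veronese k d) (moduleClosure (veronese k d) (veroneseModule k d i)) := by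
  obtain ⟨π, L, hsurj, hzero, hL⟩ := exists_classes_residuePairing (k := k) (d := d) (by omega)
  rw [isClRational_iff, eq_bot_iff]
  intro z hz
  rw [mem_moduleClosure_bot] at hz
  have hLs : ∀ (r : veronese k d) h s, L (r • h) s = L h (r • s) := by
    intro r h s
    obtain ⟨t, r', rfl⟩ := hsurj h
    rw [← map_smul, hL, hL, smul_eq_mul, residueForm_mul_left]
  obtain ⟨t, r, rfl⟩ := hsurj z
  refine hzero t r (mem_span_veroneseX_veroneseY_pow.mpr fun e he => ?_)
  by_contra! hlt
  obtain ⟨c, hc⟩ := mem_veronese_iff.mp r.2 e he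
  rw [Finsupp.degree_fin_two] at hc
  set N := d * (t + 1) with hN
  have hdeg : i ≤ (pairExp (N - 1 - e 0) (N - 1 - e 1)).degree := by
    -- The complement of e in (N - 1, N - 1) has degree 2N - 2 - deg e, and d divides both N and deg
    -- e. Hence this degree plus 2 is a positive multiple of d, which gives the bound d - 2.
    have h1 : d ∣ (N - 1 - e 0) + (N - 1 - e 1) + 2 := by
      have h2 : (N - 1 - e 0) + (N - 1 - e 1) + 2 = 2 * N - d * c := by omega
      rw [h2, hN]
      exact Nat.dvd_sub (Dvd.dvd.mul_left (dvd_mul_right _ _) _) (dvd_mul_right _ _)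
    have h3 := Nat.le_of_dvd (by omega) h1
    rw [degree_pairExp]
    omega
  obtain ⟨v, hv, hvle⟩ := exists_le_of_le_degree hdeg
  obtain ⟨w, hw⟩ := exists_add_of_le hvle
  have hvM : (monomial v 1 : MvPowerSeries (Fin 2) k) ∈ veroneseModule k d i := by
    rw [veroneseModule_eq_gradedPart (by omega)]
    refine monomial_mem_gradedPart ?_
    rw [mem_degreeExps.mp hv]
  have h1 := pairing_eq_zero_of_tmul_eq_zero L hLs _ (monomial w 1) (π t r) ⟨_, hvM⟩ (hz _)
  rw [hL, residueForm_apply, monomial_mul_monomial, one_mul, add_comm w, ← hw, ← hN] at h1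
  have h2 : pairExp (N - 1) (N - 1) = e + pairExp (N - 1 - e 0) (N - 1 - e 1) := by
    conv_rhs => rw [eq_pairExp e]
    rw [pairExp_add, pairExp_zero, pairExp_one]
    congr 1 <;> omega
  rw [h2, coeff_add_mul_monomial, mul_one] at h1
  exact he h1

theorem exists_monomial_mul_eq_smul_add_smul {f : MvPowerSeries (Fin 2) k} (hd : 2 ≤ d)
    (hf : f ∈ gradedPart k d (d - 1)) :
    ∃ p ∈ gradedPart k d (d - 1), ∃ q ∈ gradedPart k d (d - 1),
      monomial (pairExp (d - 1) 1) 1 * f = veroneseX k d • p + veroneseY k d • q := by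
  have hne : pairExp d 0 ≠ pairExp 0 d := fun h => by
    have := congrArg (fun e => e 0) h
    simp only [pairExp_zero] at this
    omega
  obtain ⟨g, hg, hgm⟩ := exists_eq_sum_monomial_mul_of_mem_gradedPart (i := d - 1) (j := 0)
    {pairExp d 0, pairExp 0 d}
    (mul_mem_gradedPart (monomial_mem_gradedPart (w := pairExp (d - 1) 1) (i := 0) (by
      rw [degree_pairExp, Nat.sub_add_cancel (by omega), Nat.modEq_zero_iff_dvd])) hf)
    (fun w hw => by
      rw [Finset.mem_insert, Finset.mem_singleton] at hw
      rcases hw with rfl | rfl <;> simp)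
    (fun e he => by
      have hle := le_of_coeff_monomial_mul_ne_zero he
      obtain ⟨q, rfl⟩ := exists_add_of_le hle
      rw [coeff_add_monomial_mul, one_mul] at he
      have h1 : d - 1 ≤ q.degree := by
        have h2 := hf q he
        rw [Nat.ModEq, Nat.mod_eq_of_lt (by omega : d - 1 < d)] at h2
        exact h2 ▸ Nat.mod_le _ _
      rw [Finsupp.degree_fin_two] at h1
      -- If x divides the monomial of `f`, then multiplying by x^(d-1) y gives a multiple of x^d.
      -- Otherwise that monomial is a power of y with exponent at least d - 1, and the factor y
      -- completes y^d.
      rcases Nat.eq_zero_or_pos (q 0) with h | h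
      · refine ⟨_, Finset.mem_insert_of_mem (Finset.mem_singleton_self _), ?_⟩
        simp only [Finsupp.le_fin_two, Finsupp.add_apply, pairExp_zero, pairExp_one]
        omega
      · refine ⟨_, Finset.mem_insert_self _ _, ?_⟩
        simp only [Finsupp.le_fin_two, Finsupp.add_apply, pairExp_zero, pairExp_one]
        omega)
  rw [Finset.sum_pair hne] at hg
  exact ⟨_, hgm _ (Finset.mem_insert_self _ _), _,
    hgm _ (Finset.mem_insert_of_mem (Finset.mem_singleton_self _)), hg⟩

theorem not_isClRational_veroneseModule (hd : 2 ≤ d) :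
    ¬ IsClRational (veronese k d)
      (moduleClosure (veronese k d) (veroneseModule k d (d - 1))) := by
  classical
  obtain ⟨π, L, -, hzero, hL⟩ := exists_classes_residuePairing (k := k) (d := d) (by omega)
  rw [isClRational_iff, veroneseModule_eq_gradedPart (by omega)]
  intro h
  let r : veronese k d := veroneseMonomial (pairExp (d - 1) 1) (by
    rw [degree_pairExp, Nat.sub_add_cancel (by omega)])
  have hX : veroneseX k d • π 0 1 = 0 := by
    rw [← map_smul, smul_eq_mul, mul_one]
    refine hzero 0 _ (Ideal.subset_span ?_)
    simp
  have hY : veroneseY k d • π 0 1 = 0 := by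
    rw [← map_smul, smul_eq_mul, mul_one]
    refine hzero 0 _ (Ideal.subset_span ?_)
    simp
  have hmem : π 0 r ∈ (moduleClosure (veronese k d) (gradedPart k d (d - 1))).cl
      (topLocalCohomology (veronese k d)) ⊥ := by
    rw [mem_moduleClosure_bot]
    intro b
    obtain ⟨p, hp, q, hq, hpq⟩ := exists_monomial_mul_eq_smul_add_smul hd b.2
    have hrb : r • b = veroneseX k d • (⟨p, hp⟩ : gradedPart k d (d - 1)) +
        veroneseY k d • (⟨q, hq⟩ : gradedPart k d (d - 1)) := Subtype.ext hpq
    -- Writing the class as r times the class of 1 lets r move across the tensor onto b, where r b =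
    -- x^d p + y^d q; then x^d and y^d move back and kill the class of 1.
    have hr1 : π 0 r = r • π 0 1 := by rw [← map_smul, smul_eq_mul, mul_one]
    rw [hr1, ← TensorProduct.smul_tmul, hrb, TensorProduct.add_tmul, TensorProduct.smul_tmul, hX,
      TensorProduct.smul_tmul, hY, TensorProduct.tmul_zero, TensorProduct.tmul_zero, add_zero]
  rw [h, Submodule.mem_bot] at hmem
  -- The monomial y^(d-2) complements x^(d-1) y to (xy)^(d-1), the monomial read off at level 0.
  have h1 : L (π 0 r) (monomial (pairExp 0 (d - 2)) 1) = 1 := by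
    rw [hL, residueForm_apply]
    change coeff _ (monomial (pairExp (d - 1) 1) 1 * monomial (pairExp 0 (d - 2)) 1) = 1
    have h2 : pairExp (d * (0 + 1) - 1) (d * (0 + 1) - 1) =
        pairExp (d - 1) 1 + pairExp 0 (d - 2) := by
      rw [pairExp_add]
      congr 1 <;> omega
    rw [monomial_mul_monomial, one_mul, h2, coeff_monomial_same]
  rw [hmem, map_zero] at h1
  exact zero_ne_one h1

end Rationality

end

theorem mainTheorem10 {k : Type u} [Field k] (d : ℕ) (hd : 2 ≤ d) :
    (IsNoetherianRing (veronese k d) ∧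
      IsAdicComplete (IsLocalRing.maximalIdeal (veronese k d)) (veronese k d) ∧
      IsMaximalCohenMacaulay (veronese k d) (veronese k d)) ∧
    (∀ i : ℕ, i ≤ d - 1 → IsMaximalCohenMacaulay (veronese k d) (veroneseModule k d i)) ∧
    (∀ i : ℕ, i ≤ d - 2 →
      IsClRational (veronese k d) (moduleClosure (veronese k d) (veroneseModule k d i))) ∧
    ¬ IsClRational (veronese k d)
      (moduleClosure (veronese k d) (veroneseModule k d (d - 1))) :=
  ⟨⟨inferInstance, veronese_isAdicComplete (by omega), isMaximalCohenMacaulay_veronese (by omega)⟩,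
    fun _ hi => isMaximalCohenMacaulay_veroneseModule (by omega),
    fun _ hi => isClRational_veroneseModule hd hi, not_isClRational_veroneseModule hd⟩
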